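/- For all real $C,\varepsilon>0$ there is $D_0$ such that the following holds for every $D\ge D_0$. Let $G_1,\dots,G_m$ be (simple, not necessarily finite) graphs of maximum degree at most $D$ that are nearly disjoint, i.e. $|V(G_i)\cap V(G_j)|\le 1$ for all distinct $i,j\in\{1,\dots,m\}$, and suppose that every vertex $v\in\bigcup_{i=1}^m V(G_i)$ is contained in at most $C$ of the sets $V(G_1),\dots,V(G_m)$. Then $$\chi_\ell\Big(\bigcup_{i=1}^m G_i\Big)\le(1+\varepsilon)D.$$ Here $\bigcup_i G_i$ is the graph with vertex set $\bigcup_i V(G_i)$ and edge set $\bigcup_i E(G_i)$, and $\chi_\ell(G)$ is the minimum $k\in\mathbb N$ such that for every assignment $L$ of finite sets of colors to the vertices of $G$ with $|L(v)|\ge k$ for all $v\in V(G)$, there is a proper coloring $\varphi$ of $G$ with $\varphi(v)\in L(v)$ for all $v\in V(G)$. -/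

import Mathlib

open scoped ENNReal

namespace SimpleGraph

universe u

/-- `G` has an `L`-coloring: a proper coloring whose color at every vertex `v` lies in `L v`. -/
def ListColorable {V : Type u} (G : SimpleGraph V) {α : Type u} (L : V → Finset α) : Prop :=
  ∃ φ : G.Coloring α, ∀ v, φ v ∈ L v

/-- `G` is `L`-colorable for every assignment `L` of finite lists of size at least `k`.
The colors range over all types in the universe of `V`; at most `max |V| ℵ₀` colors can occur
in the lists, so no list assignment is lost by this. -/
def Choosable {V : Type u} (G : SimpleGraph V) (k : ℕ) : Prop :=
  ∀ (α : Type u) (L : V → Finset α), (∀ v, k ≤ (L v).card) → G.ListColorable L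

/-- The list chromatic number: the least `k` such that `G` is `L`-colorable whenever all lists
have size at least `k` (`⊤` if there is no such `k`). -/
noncomputable def listChromaticNumber {V : Type u} (G : SimpleGraph V) : ℕ∞ :=
  ⨅ k ∈ {k : ℕ | G.Choosable k}, (k : ℕ∞)

/-- The supremum of the vertex degrees (`⊤` if the degrees are unbounded). -/
noncomputable def Subgraph.eMaxDegree {V : Type u} {G : SimpleGraph V} (H : G.Subgraph) : ℕ∞ :=
  ⨆ v ∈ H.verts, (H.neighborSet v).encard

/-- Any two distinct members of the family share at most one vertex. A graph whose vertices form
a subset of `V` is a subgraph of the complete graph on `V`. -/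
def NearlyDisjoint {V : Type u} {m : ℕ} (G : Fin m → (⊤ : SimpleGraph V).Subgraph) : Prop :=
  ∀ i j, i ≠ j → ((G i).verts ∩ (G j).verts).encard ≤ 1

end SimpleGraph

/-!
The proof is a semi-random nibble on color weights `x v c ≥ 0` with `∑ c, x v c = 1`, starting
from the uniform distributions on the lists. In each round every pair `(v, c)` is proposed
independently with a small probability `p * x v c`. A vertex takes a proposed color unless a
neighbor proposes the same color; colors proposed at neighbors are removed, and the weight of a
surviving color is divided by its survival probability, so the expected total weight stays `1`.

In each graph `G i` the total weight `ρ < 1` of `c` on the neighbors of `v` shrinks by a constant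
factor in expectation: about a fraction `p` of the neighbors is colored and disappears, while the
boost against proposals of `c` inside `G i` only costs a factor `1 / (1 - p * ρ)`. The proposals
from outside of `G i` are where near-disjointness enters: each of them concerns few of the neighbors
of `v` in `G i`, so all relevant weights are concentrated, and the Lovász local lemma provides a
good outcome of the round. After boundedly many rounds `ρ` is so small that the local lemma colors
the remaining vertices at once. Infinite graphs are reduced to finite ones by Rado's
selection lemma.
-/

namespace NibbleColoring

open Finset MeasureTheory ProbabilityTheory Function
open Filter (atTop Tendsto eventually_ge_atTop)

section LocalLemma

variable {Ω κ : Type*} [MeasurableSpace Ω] {P : Measure Ω} {A : κ → Set Ω}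

lemma measureReal_iInter_compl_le_add [DecidableEq κ] [IsFiniteMeasure P] (T T' : Finset κ) :
    P.real (⋂ l ∈ T', (A l)ᶜ) ≤
      P.real (⋂ l ∈ T, (A l)ᶜ) + ∑ l ∈ T \ T', P.real (A l ∩ ⋂ l ∈ T', (A l)ᶜ) := by
  have hcover : ⋂ l ∈ T', (A l)ᶜ ⊆
      (⋂ l ∈ T, (A l)ᶜ) ∪ ⋃ l ∈ T \ T', (A l ∩ ⋂ l ∈ T', (A l)ᶜ) := by
    intro ω hω
    by_cases h : ω ∈ ⋂ l ∈ T, (A l)ᶜ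
    · exact .inl h
    simp only [Set.mem_iInter, Set.mem_compl_iff, not_forall, not_not] at h
    obtain ⟨l, hl, hωl⟩ := h
    have hl' : l ∉ T' := fun h' => Set.mem_iInter₂.mp hω l h' hωl
    exact .inr (Set.mem_biUnion (mem_coe.mpr (mem_sdiff.mpr ⟨hl, hl'⟩)) ⟨hωl, hω⟩)
  calc P.real (⋂ l ∈ T', (A l)ᶜ)
      ≤ P.real ((⋂ l ∈ T, (A l)ᶜ) ∪ ⋃ l ∈ T \ T', (A l ∩ ⋂ l ∈ T', (A l)ᶜ)) :=
        measureReal_mono hcover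
    _ ≤ _ := (measureReal_union_le _ _).trans
        (by gcongr; exact measureReal_biUnion_finset_le _ _)

variable {r : κ → κ → Prop} [DecidableRel r] {T : Finset κ}

/- Conditioning on the non-neighbors of `k` does not change the probability of `A k`, while
by induction the neighbors of `k` fail to be avoided with conditional probability at most
`2 * (1 / 4)`. -/
lemma measureReal_inter_iInter_compl_le [IsFiniteMeasure P]
    (hindep : ∀ k ∈ T, ∀ T' ⊆ T, (∀ l ∈ T', ¬ r k l) →
      P.real (A k ∩ ⋂ l ∈ T', (A l)ᶜ) = P.real (A k) * P.real (⋂ l ∈ T', (A l)ᶜ))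
    (hsum : ∀ k ∈ T, ∑ l ∈ T with r k l, P.real (A l) ≤ 1 / 4)
    {k : κ} (hk : k ∈ T) {T' : Finset κ} (hT' : T' ⊆ T) :
    P.real (A k ∩ ⋂ l ∈ T', (A l)ᶜ) ≤ 2 * P.real (A k) * P.real (⋂ l ∈ T', (A l)ᶜ) := by
  classical
  induction T' using Finset.strongInduction generalizing k with
  | H T' ih =>
    set T'' := {l ∈ T' | ¬ r k l} with hT''
    have hsub : T'' ⊆ T' := filter_subset _ _
    have hdrop :
        P.real (A k ∩ ⋂ l ∈ T', (A l)ᶜ) ≤ P.real (A k) * P.real (⋂ l ∈ T'', (A l)ᶜ) := by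
      rw [← hindep k hk T'' (hsub.trans hT') fun l hl => (mem_filter.mp hl).2]
      exact measureReal_mono
        (Set.inter_subset_inter_right _ (Set.biInter_subset_biInter_left hsub))
    have hneighbors :
        ∑ l ∈ T' \ T'', P.real (A l ∩ ⋂ l ∈ T'', (A l)ᶜ) ≤ P.real (⋂ l ∈ T'', (A l)ᶜ) / 2 := by
      rcases hsub.eq_or_ssubset with heq | hss
      · simp only [heq, sdiff_self, bot_eq_empty, sum_empty]
        positivity
      calc ∑ l ∈ T' \ T'', P.real (A l ∩ ⋂ l ∈ T'', (A l)ᶜ)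
          ≤ ∑ l ∈ T' \ T'', 2 * P.real (A l) * P.real (⋂ l ∈ T'', (A l)ᶜ) :=
            sum_le_sum fun l hl => ih T'' hss (hT' (mem_sdiff.mp hl).1) (hsub.trans hT')
        _ = 2 * (∑ l ∈ T' \ T'', P.real (A l)) * P.real (⋂ l ∈ T'', (A l)ᶜ) := by
            rw [mul_sum, sum_mul]
        _ ≤ 2 * (1 / 4) * P.real (⋂ l ∈ T'', (A l)ᶜ) := by
            have hfilter : T' \ T'' ⊆ {l ∈ T | r k l} := fun l hl => by
              simp only [hT'', mem_sdiff, mem_filter, not_and, not_not] at hl ⊢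
              exact ⟨hT' hl.1, hl.2 hl.1⟩
            gcongr
            exact (sum_le_sum_of_subset_of_nonneg hfilter fun _ _ _ => measureReal_nonneg).trans
              (hsum k hk)
        _ = _ := by ring
    have hdouble : P.real (⋂ l ∈ T'', (A l)ᶜ) ≤ 2 * P.real (⋂ l ∈ T', (A l)ᶜ) := by
      linarith [measureReal_iInter_compl_le_add (P := P) (A := A) T' T'']
    calc _ ≤ _ := hdrop
      _ ≤ P.real (A k) * (2 * P.real (⋂ l ∈ T', (A l)ᶜ)) := by gcongr
      _ = _ := by ring

theorem lovasz_local_lemma [IsProbabilityMeasure P]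
    (hindep : ∀ k ∈ T, ∀ T' ⊆ T, (∀ l ∈ T', ¬ r k l) →
      P.real (A k ∩ ⋂ l ∈ T', (A l)ᶜ) = P.real (A k) * P.real (⋂ l ∈ T', (A l)ᶜ))
    (hprob : ∀ k ∈ T, P.real (A k) ≤ 1 / 4)
    (hsum : ∀ k ∈ T, ∑ l ∈ T with r k l, P.real (A l) ≤ 1 / 4) :
    0 < P.real (⋂ k ∈ T, (A k)ᶜ) := by
  classical
  suffices ∀ T' ⊆ T, 0 < P.real (⋂ k ∈ T', (A k)ᶜ) from this T subset_rfl
  intro T'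
  induction T' using Finset.induction_on with
  | empty => simp
  | insert a T' _ ih =>
    intro hT'
    obtain ⟨ha, hT'⟩ := insert_subset_iff.mp hT'
    have hsplit := measureReal_iInter_compl_le_add (P := P) (A := A) (insert a T') T'
    have hle : ∑ l ∈ insert a T' \ T', P.real (A l ∩ ⋂ l ∈ T', (A l)ᶜ) ≤
        P.real (A a ∩ ⋂ l ∈ T', (A l)ᶜ) := by
      rw [← sum_singleton (fun l => P.real (A l ∩ ⋂ l ∈ T', (A l)ᶜ)) a]
      exact sum_le_sum_of_subset_of_nonneg (by grind) fun _ _ _ => measureReal_nonneg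
    have hcond := measureReal_inter_iInter_compl_le hindep hsum ha hT'
    nlinarith [ih hT', hprob a ha]

end LocalLemma

section ProductMeasure

variable {I : Type*} {X : I → Type*}

lemma dependsOn_mem_iInter_compl {κ : Type*} {A : κ → Set (∀ i, X i)} {S : κ → Set I}
    {T : Finset κ} (h : ∀ k ∈ T, DependsOn (· ∈ A k) (S k)) :
    DependsOn (· ∈ ⋂ k ∈ T, (A k)ᶜ) (⋃ k ∈ T, S k) := by
  intro ω ω' hω
  simp only [Set.mem_iInter, Set.mem_compl_iff, eq_iff_iff]
  exact forall₂_congr fun k hk => not_congr <| iff_of_eq <|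
    h k hk fun i hi => hω i (Set.mem_biUnion (mem_coe.mpr hk) hi)

variable [∀ i, MeasurableSpace (X i)] {μ : ∀ i, Measure (X i)}

/-- The conditional expectation of `f` given all coordinates except the coordinate `a`. -/
noncomputable def average (μ : ∀ i, Measure (X i)) [DecidableEq I] (a : I) (f : (∀ i, X i) → ℝ) :
    (∀ i, X i) → ℝ :=
  fun ω => ∫ b, f (update ω a b) ∂μ a

lemma dependsOn_average [DecidableEq I] {f : (∀ i, X i) → ℝ} {S : Set I}
    (hf : DependsOn f S) (a : I) : DependsOn (average μ a f) (S \ {a}) := by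
  intro ω ω' h
  refine integral_congr_ae (.of_forall fun b => hf fun i hi => ?_)
  by_cases hia : i = a
  · subst hia
    simp
  · simp only [update_of_ne hia]
    exact h i ⟨hi, hia⟩

variable [Fintype I] [∀ i, IsProbabilityMeasure (μ i)]

section Discrete

variable [∀ i, Countable (X i)] [∀ i, DiscreteMeasurableSpace (X i)]

lemma indepFun_of_dependsOn {β γ : Type*} [MeasurableSpace β] [MeasurableSpace γ]
    {f : (∀ i, X i) → β} {g : (∀ i, X i) → γ} {S T : Set I} (hf : DependsOn f S)
    (hg : DependsOn g T) (hST : Disjoint S T) : IndepFun f g (Measure.pi μ) := by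
  classical
  have : ∀ i, Nonempty (X i) := fun i => nonempty_of_isProbabilityMeasure (μ i)
  have : Nonempty β := ⟨f fun i => Classical.arbitrary (X i)⟩
  have : Nonempty γ := ⟨g fun i => Classical.arbitrary (X i)⟩
  obtain ⟨f', hf'⟩ := dependsOn_iff_exists_comp.mp (S.coe_toFinset ▸ hf)
  obtain ⟨g', hg'⟩ := dependsOn_iff_exists_comp.mp (T.coe_toFinset ▸ hg)
  have hcoord : IndepFun (S.toFinset : Set I).domRestrict (T.toFinset : Set I).domRestrict
      (Measure.pi μ) :=
    (iIndepFun_pi (X := fun _ => id) fun _ => aemeasurable_id).indepFun_finset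
      S.toFinset T.toFinset (by simpa using hST) measurable_pi_apply
  rw [hf', hg']
  exact hcoord.comp (φ := f') (ψ := g') .of_discrete .of_discrete

lemma measureReal_inter_of_dependsOn {A B : Set (∀ i, X i)} {S T : Set I}
    (hA : DependsOn (· ∈ A) S) (hB : DependsOn (· ∈ B) T) (hST : Disjoint S T) :
    (Measure.pi μ).real (A ∩ B) = (Measure.pi μ).real A * (Measure.pi μ).real B := by
  have h := (indepFun_of_dependsOn (μ := μ) hA hB hST).measure_inter_preimage_eq_mul
    {True} {True} .of_discrete .of_discrete
  have hpre : ∀ A : Set (∀ i, X i), (· ∈ A) ⁻¹' {True} = A := fun A => by ext; simp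
  rw [hpre, hpre] at h
  simp only [measureReal_def, h, ENNReal.toReal_mul]

lemma integral_prod_of_dependsOn {κ : Type*} {f : κ → (∀ i, X i) → ℝ} {S : κ → Set I}
    (T : Finset κ) (hf : ∀ k, DependsOn (f k) (S k)) (hS : Pairwise (Disjoint on S)) :
    ∫ ω, ∏ k ∈ T, f k ω ∂Measure.pi μ = ∏ k ∈ T, ∫ ω, f k ω ∂Measure.pi μ := by
  classical
  induction T using Finset.induction_on with
  | empty => simp
  | insert a T ha ih =>
    have hdep : DependsOn (fun ω => ∏ k ∈ T, f k ω) (⋃ k ∈ T, S k) := fun ω ω' h =>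
      prod_congr rfl fun k hk => hf k fun i hi => h i (Set.mem_biUnion (mem_coe.mpr hk) hi)
    have hdisj : Disjoint (S a) (⋃ k ∈ T, S k) :=
      Set.disjoint_iUnion₂_right.mpr fun k hk => hS (ne_of_mem_of_not_mem hk ha).symm
    simp only [prod_insert ha]
    rw [(indepFun_of_dependsOn (hf a) hdep hdisj).integral_fun_mul_eq_mul_integral .of_discrete
      .of_discrete, ih]

open scoped Classical in
theorem frequently_forall_notMem_of_dependsOn {κ : Type*} (A : κ → Set (∀ i, X i))
    (S : κ → Set I) (T : Finset κ) (hdep : ∀ k ∈ T, DependsOn (· ∈ A k) (S k))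
    (hprob : ∀ k ∈ T, (Measure.pi μ).real (A k) ≤ 1 / 4)
    (hsum : ∀ k ∈ T, ∑ l ∈ T with ¬ Disjoint (S k) (S l), (Measure.pi μ).real (A l) ≤ 1 / 4) :
    ∃ᶠ ω in ae (Measure.pi μ), ∀ k ∈ T, ω ∉ A k := by
  have hpos := lovasz_local_lemma (P := Measure.pi μ) (A := A) (T := T)
    (r := fun k l => ¬ Disjoint (S k) (S l)) (fun k hk T' hT' hr => ?_) hprob hsum
  · rw [frequently_ae_iff]
    intro h
    refine hpos.ne' ?_
    rw [measureReal_def, ENNReal.toReal_eq_zero_iff]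
    left
    convert h using 2
    ext
    simp
  · refine measureReal_inter_of_dependsOn (hdep k hk)
      (dependsOn_mem_iInter_compl fun l hl => hdep l (hT' hl)) ?_
    simpa only [Set.disjoint_iUnion_right, not_not] using hr

end Discrete

section Average

variable [DecidableEq I]

lemma measurePreserving_update (a : I) :
    MeasurePreserving (fun y : (∀ i, X i) × X a => update y.1 a y.2)
      ((Measure.pi μ).prod (μ a)) (Measure.pi μ) := by
  have hmeas : Measurable fun y : (∀ i, X i) × X a => update y.1 a y.2 :=
    measurable_pi_lambda _ fun i => by
      by_cases hi : i = a
      · subst hi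
        simpa using measurable_snd
      · simpa [hi] using measurable_fst.eval
  refine ⟨hmeas, (Measure.pi_eq fun s hs => ?_).symm⟩
  have hpre : (fun y : (∀ i, X i) × X a => update y.1 a y.2) ⁻¹' Set.univ.pi s =
      (univ.erase a : Set I).pi s ×ˢ s a := by
    ext y
    rw [Set.mem_preimage, Set.mem_univ_pi, Set.mem_prod, Set.mem_pi]
    rw [forall_update_iff y.1 (p := fun i x => x ∈ s i)]
    simp [and_comm]
  rw [Measure.map_apply hmeas (.univ_pi hs), hpre, Measure.prod_prod, Measure.pi_pi_finset,
    prod_erase_mul _ _ (mem_univ a)]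

lemma integral_average (a : I) {f : (∀ i, X i) → ℝ} (hf : Integrable f (Measure.pi μ)) :
    ∫ ω, average μ a f ω ∂Measure.pi μ = ∫ ω, f ω ∂Measure.pi μ := by
  have hpres := measurePreserving_update (μ := μ) a
  have hint := hpres.integrable_comp_of_integrable hf
  simp only [average]
  rw [← integral_prod (fun y => f (update y.1 a y.2)) hint,
    ← integral_map hpres.aemeasurable (hpres.map_eq.symm ▸ hf.aestronglyMeasurable), hpres.map_eq]

end Average

end ProductMeasure

lemma exp_le_one_add_add_sq {x : ℝ} (hx : |x| ≤ 1) : Real.exp x ≤ 1 + x + x ^ 2 := by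
  linarith [(abs_le.mp (Real.abs_exp_sub_one_sub_id_le hx)).2]

/- Both exponentials are expanded to second order around the mean, where the linear terms
cancel. -/
lemma two_point_exp_le {p : unitInterval} {a b : ℝ} (hab : |a - b| ≤ 1) :
    p * Real.exp a + (1 - p) * Real.exp b ≤
      Real.exp (p * a + (1 - p) * b + p * (a - b) ^ 2) := by
  have hp0 : 0 ≤ (p : ℝ) := p.2.1
  have hp1 : 0 ≤ 1 - (p : ℝ) := sub_nonneg.mpr p.2.2
  set m := p * a + (1 - p) * b
  set d := a - b
  have ha : Real.exp a ≤ Real.exp m * (1 + (1 - p) * d + ((1 - p) * d) ^ 2) := by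
    rw [show a = m + (1 - p) * d by ring, Real.exp_add]
    gcongr
    refine exp_le_one_add_add_sq ?_
    rw [abs_mul, abs_of_nonneg hp1]
    exact mul_le_one₀ (by linarith) (abs_nonneg d) hab
  have hb : Real.exp b ≤ Real.exp m * (1 + -p * d + (-p * d) ^ 2) := by
    rw [show b = m + -p * d by ring, Real.exp_add]
    gcongr
    refine exp_le_one_add_add_sq ?_
    rw [abs_mul, abs_neg, abs_of_nonneg hp0]
    exact mul_le_one₀ p.2.2 (abs_nonneg d) hab
  calc p * Real.exp a + (1 - p) * Real.exp b
      ≤ p * (Real.exp m * (1 + (1 - p) * d + ((1 - p) * d) ^ 2)) +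
          (1 - p) * (Real.exp m * (1 + -p * d + (-p * d) ^ 2)) := by gcongr
    _ = Real.exp m * ((1 - p) * (p * d ^ 2) + 1) := by ring
    _ ≤ Real.exp m * (1 * (p * d ^ 2) + 1) := by
        gcongr
        linarith
    _ ≤ Real.exp m * Real.exp (p * d ^ 2) := by
        rw [one_mul]
        gcongr
        exact Real.add_one_le_exp _
    _ = _ := by rw [← Real.exp_add]

section Bits

variable {I : Type*} {q : I → unitInterval}

section Average

variable [DecidableEq I]

lemma average_bits (a : I) (f : (I → Bool) → ℝ) (ω : I → Bool) :
    average (fun i => bernoulliMeasure true false (q i)) a f ω =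
      q a * f (update ω a true) + (1 - q a) * f (update ω a false) := by
  simp [average, integral_bernoulliMeasure]

lemma abs_average_bits_update_sub_le {f : (I → Bool) → ℝ} {c : I → ℝ} (a : I)
    (hf : ∀ ω i, |f (update ω i true) - f (update ω i false)| ≤ c i) (ω : I → Bool) (i : I) :
    |average (fun i => bernoulliMeasure true false (q i)) a f (update ω i true) -
      average (fun i => bernoulliMeasure true false (q i)) a f (update ω i false)| ≤ c i := by
  rcases eq_or_ne i a with rfl | hia
  · simpa [average] using (abs_nonneg _).trans (hf ω i)
  · have hcomm : ∀ b b', update (update ω i b) a b' = update (update ω a b') i b :=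
      fun b b' => update_comm hia _ _ _
    have htrue := abs_le.mp (hf (update ω a true) i)
    have hfalse := abs_le.mp (hf (update ω a false) i)
    rw [average_bits, average_bits, hcomm, hcomm, hcomm, hcomm, abs_le]
    constructor <;> nlinarith [(q a).2.1, (q a).2.2]

end Average

variable [Fintype I]

/-- The law of independent random bits, where the bit `i` succeeds (is `true`) with
probability `q i`. -/
noncomputable abbrev bits (q : I → unitInterval) : Measure (I → Bool) :=
  Measure.pi fun i => bernoulliMeasure true false (q i)

lemma integrable_bits {f : (I → Bool) → ℝ} : Integrable f (bits q) := .of_finite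

lemma measureReal_bits_forall_eq_true (F : Finset I) :
    (bits q).real {ω | ∀ e ∈ F, ω e = true} = ∏ e ∈ F, (q e : ℝ) := by
  have hbox : {ω : I → Bool | ∀ e ∈ F, ω e = true} = (F : Set I).pi fun _ => {true} := by
    ext
    simp
  rw [hbox, measureReal_def, Measure.pi_pi_finset, ENNReal.toReal_prod]
  refine prod_congr rfl fun e _ => ?_
  rw [← measureReal_def, bernoulliMeasure_real_apply_of_mem_of_notMem] <;> simp

section BoundedDifferences

variable [DecidableEq I]

variable {f : (I → Bool) → ℝ} {c : I → ℝ}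

/- Averaging out one coordinate after the other, each costs a factor `exp (q i * c i ^ 2)`. -/
theorem integral_exp_bits_le (hf : ∀ ω i, |f (update ω i true) - f (update ω i false)| ≤ c i)
    (hc : ∀ i, c i ≤ 1) :
    ∫ ω, Real.exp (f ω) ∂bits q ≤
      Real.exp (∫ ω, f ω ∂bits q + ∑ i, q i * c i ^ 2) := by
  suffices ∀ J : Finset I, DependsOn f J →
      ∫ ω, Real.exp (f ω) ∂bits q ≤ Real.exp (∫ ω, f ω ∂bits q + ∑ i ∈ J, q i * c i ^ 2) from
    this univ (by simpa using dependsOn_univ f)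
  intro J hJ
  induction J using Finset.induction_on generalizing f with
  | empty =>
    obtain ⟨m, rfl⟩ : ∃ m, f = fun _ => m :=
      ⟨f fun _ => false, funext fun ω => (by simpa using hJ : DependsOn f ∅).empty _ _⟩
    simp
  | insert a J ha ih =>
    set g := average (fun i => bernoulliMeasure true false (q i)) a f with hg
    have hgJ : DependsOn g J :=
      (dependsOn_average hJ a).mono fun i hi => (mem_insert.mp hi.1).resolve_left hi.2
    have hstep : ∀ ω, average (fun i => bernoulliMeasure true false (q i)) a
        (fun ω => Real.exp (f ω)) ω ≤ Real.exp (q a * c a ^ 2) * Real.exp (g ω) := by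
      intro ω
      rw [average_bits, hg, average_bits, ← Real.exp_add]
      refine (two_point_exp_le ((hf ω a).trans (hc a))).trans (Real.exp_le_exp.mpr ?_)
      have hsq := mul_le_mul_of_nonneg_left (sq_le_sq' (abs_le.mp (hf ω a)).1
        (abs_le.mp (hf ω a)).2) (q a).2.1
      linarith
    calc ∫ ω, Real.exp (f ω) ∂bits q
        = ∫ ω, average (fun i => bernoulliMeasure true false (q i)) a
            (fun ω => Real.exp (f ω)) ω ∂bits q := (integral_average a integrable_bits).symm
      _ ≤ ∫ ω, Real.exp (q a * c a ^ 2) * Real.exp (g ω) ∂bits q :=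
          integral_mono integrable_bits integrable_bits hstep
      _ ≤ Real.exp (q a * c a ^ 2) *
            Real.exp (∫ ω, g ω ∂bits q + ∑ i ∈ J, q i * c i ^ 2) := by
          rw [integral_const_mul]
          gcongr
          exact ih (abs_average_bits_update_sub_le a hf) hgJ
      _ = _ := by
          rw [← Real.exp_add, integral_average a integrable_bits, sum_insert ha]
          ring_nf

theorem measureReal_bits_integral_add_le (hf : ∀ ω i,
    |f (update ω i true) - f (update ω i false)| ≤ c i) {s v : ℝ} (hs : 0 ≤ s)
    (hsc : ∀ i, s * c i ≤ 1) (hv : ∑ i, q i * c i ^ 2 ≤ v) (t : ℝ) :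
    (bits q).real {ω | ∫ ω', f ω' ∂bits q + t ≤ f ω} ≤ Real.exp (s ^ 2 * v - s * t) := by
  have hsf : ∀ ω i, |s * f (update ω i true) - s * f (update ω i false)| ≤ s * c i := by
    intro ω i
    rw [← mul_sub, abs_mul, abs_of_nonneg hs]
    exact mul_le_mul_of_nonneg_left (hf ω i) hs
  calc (bits q).real {ω | ∫ ω', f ω' ∂bits q + t ≤ f ω}
      ≤ Real.exp (-s * (∫ ω, f ω ∂bits q + t)) * ∫ ω, Real.exp (s * f ω) ∂bits q :=
        measure_ge_le_exp_mul_mgf _ hs integrable_bits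
    _ ≤ Real.exp (-s * (∫ ω, f ω ∂bits q + t)) *
          Real.exp (∫ ω, s * f ω ∂bits q + ∑ i, q i * (s * c i) ^ 2) := by
        gcongr
        exact integral_exp_bits_le hsf hsc
    _ = Real.exp (s ^ 2 * ∑ i, q i * c i ^ 2 - s * t) := by
        have hsq : ∑ i, q i * (s * c i) ^ 2 = s ^ 2 * ∑ i, q i * c i ^ 2 := by
          rw [mul_sum]
          exact sum_congr rfl fun i _ => by ring
        rw [← Real.exp_add, integral_const_mul, hsq]
        ring_nf
    _ ≤ _ := by gcongr

end BoundedDifferences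

end Bits

/-- The total weight of those events `A k`, `k ∈ s`, that occur, where `A k` has weight `a k`. -/
noncomputable def eventWeight {Ω κ : Type*} (s : Finset κ) (a : κ → ℝ) (A : κ → Set Ω) (ω : Ω) :
    ℝ :=
  ∑ k ∈ s, (A k).indicator (fun _ => a k) ω

section EventWeight

variable {I κ : Type*} {q : I → unitInterval} {s : Finset κ} {a : κ → ℝ}
  {A : κ → Set (I → Bool)}

lemma mul_eventWeight {Ω : Type*} {A : κ → Set Ω} (r : ℝ) (ω : Ω) :
    r * eventWeight s a A ω = eventWeight s (fun k => r * a k) A ω := by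
  classical
  simp only [eventWeight, mul_sum, Set.indicator_apply, mul_ite, mul_zero]

lemma abs_eventWeight_update_sub_le [DecidableEq I] {F : κ → Finset I} (ha : ∀ k ∈ s, 0 ≤ a k)
    (hA : ∀ k ∈ s, DependsOn (· ∈ A k) (F k)) (ω : I → Bool) (i : I) :
    |eventWeight s a A (update ω i true) - eventWeight s a A (update ω i false)| ≤
      ∑ k ∈ s with i ∈ F k, a k := by
  classical
  rw [eventWeight, eventWeight, ← sum_sub_distrib, sum_filter]
  refine (abs_sum_le_sum_abs _ _).trans (sum_le_sum fun k hk => ?_)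
  have hak := ha k hk
  split_ifs with hi
  · simp only [Set.indicator_apply]
    split_ifs <;> simp [abs_of_nonneg hak, hak]
  · have hiff : update ω i true ∈ A k ↔ update ω i false ∈ A k :=
      iff_of_eq <| hA k hk fun e he => by
        have hne : e ≠ i := fun h => hi (h ▸ he)
        simp only [update_of_ne hne]
    simp only [Set.indicator_apply, hiff, sub_self, abs_zero, le_refl]

variable [Fintype I]

lemma integral_eventWeight_bits :
    ∫ ω, eventWeight s a A ω ∂bits q = ∑ k ∈ s, a k * (bits q).real (A k) := by
  simp only [eventWeight]
  rw [integral_finsetSum _ fun _ _ => integrable_bits]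
  refine sum_congr rfl fun k _ => ?_
  rw [integral_indicator_const _ .of_discrete, smul_eq_mul, mul_comm]

variable [DecidableEq I] {F : κ → Finset I}

lemma sum_mul_sum_filter_sq_le {B v : ℝ} (ha : ∀ k ∈ s, 0 ≤ a k)
    (hB : ∀ e, ∑ k ∈ s with e ∈ F k, a k ≤ B) (hB0 : 0 ≤ B)
    (hv : ∑ k ∈ s, a k * ∑ e ∈ F k, (q e : ℝ) ≤ v) :
    ∑ e, q e * (∑ k ∈ s with e ∈ F k, a k) ^ 2 ≤ B * v := by
  have hswap : ∑ e, q e * ∑ k ∈ s with e ∈ F k, a k = ∑ k ∈ s, a k * ∑ e ∈ F k, (q e : ℝ) := by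
    simp only [sum_filter, mul_sum]
    rw [sum_comm]
    refine sum_congr rfl fun k _ => ?_
    simp only [mul_ite, mul_zero, sum_ite_mem, univ_inter, mul_comm]
  calc ∑ e, q e * (∑ k ∈ s with e ∈ F k, a k) ^ 2
      ≤ ∑ e, q e * (B * ∑ k ∈ s with e ∈ F k, a k) := by
        refine sum_le_sum fun e _ => mul_le_mul_of_nonneg_left ?_ (q e).2.1
        rw [sq]
        exact mul_le_mul_of_nonneg_right (hB e)
          (sum_nonneg fun k hk => ha k (mem_filter.mp hk).1)
    _ = B * ∑ e, q e * ∑ k ∈ s with e ∈ F k, a k := by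
        rw [mul_sum]
        exact sum_congr rfl fun e _ => mul_left_comm _ _ _
    _ ≤ B * v := by
        rw [hswap]
        gcongr

variable {B v r m : ℝ}

theorem measureReal_add_le_eventWeight_le (ha : ∀ k ∈ s, 0 ≤ a k)
    (hA : ∀ k ∈ s, DependsOn (· ∈ A k) (F k)) (hB : ∀ e, ∑ k ∈ s with e ∈ F k, a k ≤ B)
    (hB0 : 0 ≤ B) (hv : ∑ k ∈ s, a k * ∑ e ∈ F k, (q e : ℝ) ≤ v) (hr : 0 ≤ r) (hrB : r * B ≤ 1)
    (hm : ∑ k ∈ s, a k * (bits q).real (A k) ≤ m) (t : ℝ) :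
    (bits q).real {ω | m + t ≤ eventWeight s a A ω} ≤ Real.exp (r ^ 2 * (B * v) - r * t) := by
  refine (measureReal_mono fun ω hω => ?_).trans
    (measureReal_bits_integral_add_le (abs_eventWeight_update_sub_le ha hA) hr
      (fun e => (mul_le_mul_of_nonneg_left (hB e) hr).trans hrB)
      (sum_mul_sum_filter_sq_le ha hB hB0 hv) t)
  rw [Set.mem_ofPred_eq] at hω ⊢
  rw [integral_eventWeight_bits]
  linarith

theorem measureReal_eventWeight_le_sub_le (ha : ∀ k ∈ s, 0 ≤ a k)
    (hA : ∀ k ∈ s, DependsOn (· ∈ A k) (F k)) (hB : ∀ e, ∑ k ∈ s with e ∈ F k, a k ≤ B)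
    (hB0 : 0 ≤ B) (hv : ∑ k ∈ s, a k * ∑ e ∈ F k, (q e : ℝ) ≤ v) (hr : 0 ≤ r) (hrB : r * B ≤ 1)
    (hm : m ≤ ∑ k ∈ s, a k * (bits q).real (A k)) (t : ℝ) :
    (bits q).real {ω | eventWeight s a A ω ≤ m - t} ≤ Real.exp (r ^ 2 * (B * v) - r * t) := by
  have hneg : ∀ ω i, |-eventWeight s a A (update ω i true) - -eventWeight s a A (update ω i false)|
      ≤ ∑ k ∈ s with i ∈ F k, a k := fun ω i => by
    rw [neg_sub_neg, abs_sub_comm]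
    exact abs_eventWeight_update_sub_le ha hA ω i
  refine (measureReal_mono fun ω hω => ?_).trans
    (measureReal_bits_integral_add_le (f := fun ω => -eventWeight s a A ω) hneg hr
      (fun e => (mul_le_mul_of_nonneg_left (hB e) hr).trans hrB)
      (sum_mul_sum_filter_sq_le ha hB hB0 hv) t)
  rw [Set.mem_ofPred_eq] at hω ⊢
  rw [integral_neg, integral_eventWeight_bits]
  linarith

end EventWeight

section Collisions

variable {I : Type*} {q : I → unitInterval} {b : I → ℝ} {s : Finset I}

/-- The outcomes in which the bit `i` succeeds. -/
def success (i : I) : Set (I → Bool) :=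
  {ω | ω i = true}

/-- The outcomes in which no bit in `F` succeeds. -/
def silent (F : Finset I) : Set (I → Bool) :=
  {ω | ∀ e ∈ F, ω e = false}

/-- The outcomes in which the bit `u` succeeds together with some bit in `F`. -/
def collision (u : I) (F : Finset I) : Set (I → Bool) :=
  success u ∩ ⋃ w ∈ F, success w

@[simp]
lemma mem_success {i : I} {ω : I → Bool} : ω ∈ success i ↔ ω i = true := Iff.rfl

@[simp]
lemma mem_silent {F : Finset I} {ω : I → Bool} : ω ∈ silent F ↔ ∀ e ∈ F, ω e = false := Iff.rfl

@[simp]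
lemma mem_collision {u : I} {F : Finset I} {ω : I → Bool} :
    ω ∈ collision u F ↔ ω u = true ∧ ∃ w ∈ F, ω w = true := by
  simp [collision]

lemma dependsOn_mem_success (i : I) : DependsOn (· ∈ success i) {i} := fun _ _ h => by
  simp only [mem_success, h i rfl]

lemma dependsOn_mem_silent (F : Finset I) : DependsOn (· ∈ silent F) F := fun _ _ h => by
  simp only [mem_silent, eq_iff_iff]
  exact forall₂_congr fun e he => by rw [h e he]

lemma dependsOn_mem_collision (u : I) (F : Finset I) :
    DependsOn (· ∈ collision u F) (insert u (F : Set I)) := fun _ _ h => by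
  simp only [mem_collision, h u (Set.mem_insert _ _), eq_iff_iff]
  refine and_congr_right fun _ => exists_congr fun w => and_congr_right fun hw => ?_
  rw [h w (Set.mem_insert_of_mem _ hw)]

lemma dependsOn_eventWeight {κ : Type*} {t : Finset κ} {a : κ → ℝ} {A : κ → Set (I → Bool)}
    {S : Set I} (h : ∀ k ∈ t, DependsOn (· ∈ A k) S) : DependsOn (eventWeight t a A) S := by
  classical
  intro ω ω' hω
  refine sum_congr rfl fun k hk => ?_
  have hiff : ω ∈ A k ↔ ω' ∈ A k := iff_of_eq (h k hk hω)
  simp only [Set.indicator_apply, hiff]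

lemma exp_eventWeight_collision_le {R : I → Finset I} (hb0 : ∀ i, 0 ≤ b i) (ω : I → Bool) :
    Real.exp (eventWeight s b (fun u => collision u (R u)) ω) ≤
      1 + ∑ u ∈ s, b u * ∑ w ∈ R u, (success u ∩ success w).indicator
        (fun ω => Real.exp (eventWeight s b success ω)) ω := by
  set X := eventWeight s b success ω
  set Y := eventWeight s b (fun u => collision u (R u)) ω with hY
  have hYX : Y ≤ X := sum_le_sum fun u _ =>
    Set.indicator_le_indicator_of_subset (fun ω h => h.1) (fun _ => hb0 u) ω
  have hexp : Real.exp Y ≤ 1 + Y * Real.exp Y := by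
    have h := mul_le_mul_of_nonneg_right (Real.one_sub_le_exp_neg Y) (Real.exp_pos Y).le
    rw [← Real.exp_add, neg_add_cancel, Real.exp_zero] at h
    linarith
  have hterm : ∀ u ∈ s, (collision u (R u)).indicator (fun _ => b u) ω * Real.exp X ≤
      b u * ∑ w ∈ R u, (success u ∩ success w).indicator
        (fun ω => Real.exp (eventWeight s b success ω)) ω := by
    intro u _
    have hnonneg : ∀ w ∈ R u, 0 ≤ (success u ∩ success w).indicator
        (fun ω => Real.exp (eventWeight s b success ω)) ω :=
      fun w _ => Set.indicator_nonneg (fun _ _ => (Real.exp_pos _).le) ω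
    by_cases h : ω ∈ collision u (R u)
    · obtain ⟨hωu, w, hw, hωw⟩ := mem_collision.mp h
      have hmem : ω ∈ success u ∩ success w := ⟨hωu, hωw⟩
      rw [Set.indicator_of_mem h]
      refine mul_le_mul_of_nonneg_left ?_ (hb0 u)
      refine le_trans (le_of_eq ?_) (single_le_sum hnonneg hw)
      rw [Set.indicator_of_mem hmem]
    · rw [Set.indicator_of_notMem h, zero_mul]
      exact mul_nonneg (hb0 u) (sum_nonneg hnonneg)
  have hY0 : 0 ≤ Y := sum_nonneg fun u _ => Set.indicator_nonneg (fun _ _ => hb0 u) ω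
  calc Real.exp Y ≤ 1 + Y * Real.exp X := by
        refine hexp.trans ?_
        gcongr
    _ ≤ _ := by
        rw [hY, eventWeight, sum_mul]
        exact add_le_add_right (sum_le_sum hterm) 1

lemma eventWeight_success_le_add [DecidableEq I] (hb0 : ∀ i, 0 ≤ b i) (hb : ∀ i, b i ≤ 1 / 4)
    {u w : I} (huw : u ≠ w) (ω : I → Bool) :
    eventWeight s b success ω ≤ 1 / 2 + eventWeight (s \ {u, w}) b success ω := by
  have hind : ∀ i, 0 ≤ (success i).indicator (fun _ => b i) ω :=
    fun i => Set.indicator_nonneg (fun _ _ => hb0 i) ω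
  have hpair : ∑ i ∈ {u, w}, (success i).indicator (fun _ => b i) ω ≤ 1 / 2 := by
    refine (sum_le_card_nsmul _ _ (1 / 4) fun i _ =>
      (Set.indicator_le_self' (fun _ _ => hb0 i) ω).trans (hb i)).trans ?_
    rw [card_pair huw]
    norm_num
  calc eventWeight s b success ω
      ≤ ∑ i ∈ {u, w} ∪ s \ {u, w}, (success i).indicator (fun _ => b i) ω := by
        refine sum_le_sum_of_subset_of_nonneg ?_ fun i _ _ => hind i
        rw [union_sdiff_self_eq_union]
        exact subset_union_right
    _ ≤ _ := by
        rw [sum_union disjoint_sdiff]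
        gcongr
        exact le_rfl

variable [Fintype I]

lemma measureReal_silent (F : Finset I) :
    (bits q).real (silent F) = ∏ e ∈ F, (1 - (q e : ℝ)) := by
  have hbox : silent F = (F : Set I).pi fun _ => {false} := by
    ext
    simp
  rw [hbox, measureReal_def, Measure.pi_pi_finset, ENNReal.toReal_prod]
  refine prod_congr rfl fun e _ => ?_
  rw [← measureReal_def, bernoulliMeasure_real_apply_of_notMem_of_mem] <;> simp

lemma measureReal_silent_union [DecidableEq I] {F F' : Finset I} (h : Disjoint F F') :
    (bits q).real (silent (F ∪ F')) = (bits q).real (silent F) * (bits q).real (silent F') := by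
  simp only [measureReal_silent, prod_union h]

lemma measureReal_silent_le_exp (F : Finset I) :
    (bits q).real (silent F) ≤ Real.exp (-∑ e ∈ F, (q e : ℝ)) := by
  rw [measureReal_silent, ← sum_neg_distrib, Real.exp_sum]
  exact prod_le_prod (fun e _ => sub_nonneg.mpr (q e).2.2) fun e _ => Real.one_sub_le_exp_neg _

lemma measureReal_success (i : I) : (bits q).real (success i) = q i := by
  simpa [success] using measureReal_bits_forall_eq_true (q := q) {i}

lemma one_sub_sum_le_measureReal_silent (F : Finset I) :
    1 - ∑ e ∈ F, (q e : ℝ) ≤ (bits q).real (silent F) := by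
  have hcompl : (silent F)ᶜ = ⋃ e ∈ F, success e := by
    ext
    simp
  have hunion := measureReal_biUnion_finset_le (μ := bits q) F success
  rw [← hcompl, probReal_compl_eq_one_sub .of_discrete] at hunion
  simp only [measureReal_success] at hunion
  linarith

lemma integral_exp_eventWeight_success_le (hb0 : ∀ i, 0 ≤ b i) (hb1 : ∀ i, b i ≤ 1) :
    ∫ ω, Real.exp (eventWeight s b success ω) ∂bits q ≤
      Real.exp (2 * ∑ i ∈ s, q i * b i) := by
  classical
  have hdep : ∀ i ∈ s, DependsOn (· ∈ success i) (({i} : Finset I) : Set I) := fun i _ => by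
    simpa using dependsOn_mem_success i
  have hc : ∀ i, ∑ k ∈ s with i ∈ ({k} : Finset I), b k = if i ∈ s then b i else 0 := fun i => by
    simp [sum_filter]
  refine (integral_exp_bits_le (abs_eventWeight_update_sub_le (fun i _ => hb0 i) hdep)
    fun i => ?_).trans (Real.exp_le_exp.mpr ?_)
  · rw [hc]
    split_ifs
    exacts [hb1 i, zero_le_one]
  · rw [integral_eventWeight_bits, two_mul]
    simp only [measureReal_success, hc, ite_pow, mul_ite, zero_pow two_ne_zero, mul_zero,
      sum_ite_mem, univ_inter, mul_comm (b _)]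
    gcongr with i
    · exact (q i).2.1
    · exact pow_le_of_le_one (hb0 i) (hb1 i) two_ne_zero

lemma measureReal_bits_success_inter_success {u w : I} (huw : u ≠ w) :
    (bits q).real (success u ∩ success w) = q u * q w := by
  classical
  have h := measureReal_bits_forall_eq_true (q := q) {u, w}
  rw [prod_pair huw] at h
  rw [← h]
  congr
  ext
  simp

/- The weights of the two bits `u` and `w` contribute at most a factor `exp (1 / 2)`, and
the other bits are independent of them. -/
lemma integral_exp_eventWeight_success_of_mem_le (hb0 : ∀ i, 0 ≤ b i) (hb : ∀ i, b i ≤ 1 / 4)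
    (hsum : ∑ i ∈ s, q i * b i ≤ 1 / 4) {u w : I} (huw : u ≠ w) :
    ∫ ω, (success u ∩ success w).indicator
        (fun ω => Real.exp (eventWeight s b success ω)) ω ∂bits q ≤
      3 * (q u * q w) := by
  classical
  set X := eventWeight (s \ {u, w}) b success
  set E : Set (I → Bool) := success u ∩ success w
  have hindep : IndepFun (E.indicator 1 : (I → Bool) → ℝ) (fun ω => Real.exp (X ω)) (bits q) := by
    refine indepFun_of_dependsOn (S := {u, w}) (T := (s \ {u, w} : Finset I))
      (fun ω ω' h => ?_) (fun ω ω' h => congrArg Real.exp ?_) ?_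
    · simp [E, Set.indicator_apply, h u (.inl rfl), h w (.inr rfl)]
    · exact dependsOn_eventWeight
        (fun i hi => (dependsOn_mem_success i).mono (Set.singleton_subset_iff.mpr hi)) h
    · simp [Set.disjoint_sdiff_right]
  calc _ ≤ ∫ ω, Real.exp (1 / 2) * (E.indicator 1 ω * Real.exp (X ω)) ∂bits q := by
        refine integral_mono integrable_bits integrable_bits fun ω => ?_
        by_cases hω : ω ∈ E
        · simp only [Set.indicator_of_mem hω, Pi.one_apply, one_mul, ← Real.exp_add]
          exact Real.exp_le_exp.mpr (eventWeight_success_le_add hb0 hb huw ω)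
        · simp [Set.indicator_of_notMem hω]
    _ = Real.exp (1 / 2) * (q u * q w) * ∫ ω, Real.exp (X ω) ∂bits q := by
        rw [integral_const_mul, hindep.integral_fun_mul_eq_mul_integral .of_discrete .of_discrete,
          integral_indicator_one .of_discrete,
          measureReal_bits_success_inter_success huw]
        ring
    _ ≤ Real.exp (1 / 2) * (q u * q w) * Real.exp (1 / 2) := by
        have := mul_nonneg (q u).2.1 (q w).2.1
        gcongr
        refine (integral_exp_eventWeight_success_le hb0 fun i => (hb i).trans (by norm_num)).trans
          (Real.exp_le_exp.mpr ?_)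
        have := sum_le_sum_of_subset_of_nonneg (sdiff_subset (s := s) (t := {u, w}))
          fun i _ _ => mul_nonneg (q i).2.1 (hb0 i)
        linarith
    _ = Real.exp 1 * (q u * q w) := by
        rw [mul_right_comm, ← Real.exp_add]
        norm_num
    _ ≤ _ := by
        have := mul_nonneg (q u).2.1 (q w).2.1
        gcongr
        exact Real.exp_one_lt_three.le

theorem integral_exp_eventWeight_collision_le {R : I → Finset I} (hR : ∀ u, u ∉ R u)
    (hb0 : ∀ i, 0 ≤ b i) (hb : ∀ i, b i ≤ 1 / 4) (hsum : ∑ i ∈ s, q i * b i ≤ 1 / 4) :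
    ∫ ω, Real.exp (eventWeight s b (fun u => collision u (R u)) ω) ∂bits q ≤
      Real.exp (3 * ∑ u ∈ s, b u * (q u * ∑ w ∈ R u, (q w : ℝ))) := by
  calc _ ≤ ∫ ω, (1 + ∑ u ∈ s, b u * ∑ w ∈ R u,
          (success u ∩ success w).indicator
            (fun ω => Real.exp (eventWeight s b success ω)) ω) ∂bits q :=
        integral_mono integrable_bits integrable_bits (exp_eventWeight_collision_le hb0)
    _ = 1 + ∑ u ∈ s, b u * ∑ w ∈ R u, ∫ ω,
          (success u ∩ success w).indicator
            (fun ω => Real.exp (eventWeight s b success ω)) ω ∂bits q := by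
        rw [integral_add integrable_bits integrable_bits,
          integral_finsetSum _ fun _ _ => integrable_bits]
        simp only [integral_const, probReal_univ, one_smul, integral_const_mul]
        congr! 3
        exact integral_finsetSum _ fun _ _ => integrable_bits
    _ ≤ 1 + ∑ u ∈ s, b u * ∑ w ∈ R u, 3 * ((q u : ℝ) * q w) := by
        gcongr with u _ w hw
        · exact hb0 u
        · exact integral_exp_eventWeight_success_of_mem_le hb0 hb hsum fun h => hR u (h ▸ hw)
    _ = 1 + 3 * ∑ u ∈ s, b u * (q u * ∑ w ∈ R u, (q w : ℝ)) := by
        simp only [mul_sum]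
        refine congrArg (1 + ·) (sum_congr rfl fun u _ => sum_congr rfl fun w _ => ?_)
        ring
    _ ≤ _ := by
        rw [add_comm]
        exact Real.add_one_le_exp _

end Collisions

section RandomColors

variable {V α : Type*} [Fintype V] [MeasurableSpace α] [DiscreteMeasurableSpace α]
  {x : V → PMF α}

lemma measure_eval_eq_eval [Countable α] {u v : V} (huv : u ≠ v) :
    Measure.pi (fun w => (x w).toMeasure) {ω | ω u = ω v} = ∑' c, x u c * x v c := by
  classical
  have hcover : {ω : V → α | ω u = ω v} =
      ⋃ c, (({u, v} : Finset V) : Set V).pi fun _ => {c} := by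
    ext ω
    simp [eq_comm]
  have hdisj : Pairwise (Disjoint on fun c : α =>
      (({u, v} : Finset V) : Set V).pi fun _ => ({c} : Set α)) := by
    refine fun c d hcd => Set.disjoint_left.mpr fun ω hc hd => hcd ?_
    exact (hc u (by simp)).symm.trans (hd u (by simp))
  rw [hcover, measure_iUnion hdisj fun _ => .of_discrete]
  refine tsum_congr fun c => ?_
  rw [Measure.pi_pi_finset, prod_pair huv]
  simp [PMF.toMeasure_apply_singleton]

lemma ae_forall_mem_support :
    ∀ᵐ ω ∂Measure.pi (fun w => (x w).toMeasure), ∀ v, ω v ∈ (x v).support := by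
  refine Filter.eventually_all.mpr fun v => ?_
  refine (measurePreserving_eval (fun w => (x w).toMeasure) v).quasiMeasurePreserving.ae ?_
  rw [ae_iff, PMF.toMeasure_apply_eq_zero_iff _ .of_discrete]
  exact Set.disjoint_left.mpr fun c hc hc' => hc' hc

end RandomColors

/-- The neighborhood of `v` in a graph on a finite vertex set, as a finset. Unlike
`SimpleGraph.neighborFinset`, it does not refer to a decision procedure for adjacency. -/
noncomputable def neighbors {V : Type*} [Finite V] (H : SimpleGraph V) (v : V) : Finset V :=
  (H.neighborSet v).toFinite.toFinset

@[simp]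
lemma mem_neighbors {V : Type*} [Finite V] {H : SimpleGraph V} {u v : V} :
    u ∈ neighbors H v ↔ H.Adj v u := by
  simp [neighbors]

open scoped Classical in
lemma incidenceFinset_eq_image {V : Type*} [Fintype V] (H : SimpleGraph V) (v : V) :
    H.incidenceFinset v = (neighbors H v).image fun u => s(v, u) := by
  ext l
  simp only [SimpleGraph.mem_incidenceFinset, SimpleGraph.incidenceSet, mem_image, mem_neighbors]
  constructor
  · rintro ⟨hl, hv⟩
    obtain ⟨u, rfl⟩ := Sym2.mem_iff_exists.mp hv
    exact ⟨u, hl, rfl⟩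
  · rintro ⟨u, hu, rfl⟩
    exact ⟨hu, Sym2.mem_mk_left v u⟩

open scoped Classical in
lemma sum_filter_not_disjoint_edges_le {V : Type*} [Fintype V] {H : SimpleGraph V}
    {f : Sym2 V → ℝ≥0∞} {r : ℝ≥0∞} (hr : ∀ v, ∑ u ∈ neighbors H v, f s(v, u) ≤ r)
    (e : Sym2 V) :
    ∑ l ∈ H.edgeFinset with ¬ Disjoint (e : Set V) ((l : Sym2 V) : Set V), f l ≤ 2 * r := by
  have hincident : ∀ v, ∑ l ∈ H.incidenceFinset v, f l ≤ r := fun v => by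
    rw [incidenceFinset_eq_image, sum_image fun _ _ _ _ h => Sym2.congr_right.mp h]
    exact hr v
  induction e with
  | _ a b =>
    have hsub : {l ∈ H.edgeFinset | ¬ Disjoint (s(a, b) : Set V) ((l : Sym2 V) : Set V)} ⊆
        H.incidenceFinset a ∪ H.incidenceFinset b := by
      intro l hl
      obtain ⟨hlH, hmeet⟩ := mem_filter.mp hl
      obtain ⟨z, hz, hzl⟩ := Set.not_disjoint_iff.mp hmeet
      have hinc : l ∈ H.incidenceFinset z := by
        simpa [SimpleGraph.incidenceSet] using ⟨SimpleGraph.mem_edgeFinset.mp hlH, hzl⟩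
      rcases Sym2.mem_iff.mp hz with rfl | rfl
      exacts [mem_union_left _ hinc, mem_union_right _ hinc]
    calc _ ≤ ∑ l ∈ H.incidenceFinset a ∪ H.incidenceFinset b, f l := sum_le_sum_of_subset hsub
      _ ≤ ∑ l ∈ H.incidenceFinset a, f l + ∑ l ∈ H.incidenceFinset b, f l := by
        rw [← sum_union_inter]
        exact le_self_add
      _ ≤ 2 * r := by
        rw [two_mul]
        exact add_le_add (hincident a) (hincident b)

lemma sum_neighbors_measure_eval_eq_eval_le {V α : Type*} [Fintype V] [Countable α]
    [MeasurableSpace α] [DiscreteMeasurableSpace α] {H : SimpleGraph V} {x : V → PMF α}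
    {v : V} {r : ℝ≥0∞} (hr : ∀ c ∈ (x v).support, ∑ u ∈ neighbors H v, x u c ≤ r) :
    ∑ u ∈ neighbors H v, Measure.pi (fun w => (x w).toMeasure) {ω | ω v = ω u} ≤ r := by
  calc ∑ u ∈ neighbors H v, Measure.pi (fun w => (x w).toMeasure) {ω | ω v = ω u}
      = ∑ u ∈ neighbors H v, ∑' c, x v c * x u c :=
        sum_congr rfl fun u hu => measure_eval_eq_eval (mem_neighbors.mp hu).ne
    _ = ∑' c, x v c * ∑ u ∈ neighbors H v, x u c := by
        rw [← Summable.tsum_finsetSum fun _ _ => ENNReal.summable]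
        simp only [mul_sum]
    _ ≤ ∑' c, x v c * r := by
        refine ENNReal.tsum_le_tsum fun c => ?_
        by_cases hc : c ∈ (x v).support
        · gcongr
          exact hr c hc
        · simp [(PMF.apply_eq_zero_iff _ _).mpr hc]
    _ = r := by rw [ENNReal.tsum_mul_right, (x v).tsum_coe, one_mul]

theorem exists_coloring_of_sum_neighbors_le {V α : Type*} [Finite V] [Countable α]
    {H : SimpleGraph V} {x : V → PMF α}
    (hx : ∀ v, ∀ c ∈ (x v).support, ∑ u ∈ neighbors H v, x u c ≤ 1 / 8) :
    ∃ φ : H.Coloring α, ∀ v, φ v ∈ (x v).support := by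
  classical
  let _ := Fintype.ofFinite V
  let _ : MeasurableSpace α := ⊤
  let P : Measure (V → α) := Measure.pi fun v => (x v).toMeasure
  let A : Sym2 V → Set (V → α) := fun e => {ω | (e.map ω).IsDiag}
  have hA : ∀ v, ∑ u ∈ neighbors H v, P (A s(v, u)) ≤ 1 / 8 := fun v =>
    sum_neighbors_measure_eval_eq_eval_le (hx v)
  have hsum : ∀ e : Sym2 V,
      ∑ l ∈ H.edgeFinset with ¬ Disjoint (e : Set V) ((l : Sym2 V) : Set V), P.real (A l) ≤
        1 / 4 := by
    intro e
    simp only [measureReal_def]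
    rw [← ENNReal.toReal_sum fun _ _ => measure_ne_top _ _]
    refine (ENNReal.toReal_mono (by finiteness) (sum_filter_not_disjoint_edges_le hA e)).trans ?_
    norm_num [ENNReal.toReal_mul]
  have hprob : ∀ e ∈ H.edgeFinset, P.real (A e) ≤ 1 / 4 := by
    intro e he
    refine le_trans ?_ (hsum e)
    refine single_le_sum (f := fun l => P.real (A l)) (fun _ _ => measureReal_nonneg) ?_
    refine mem_filter.mpr ⟨he, ?_⟩
    induction e with
    | _ a b => exact Set.not_disjoint_iff.mpr ⟨a, Sym2.mem_mk_left a b, Sym2.mem_mk_left a b⟩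
  have hdep : ∀ e ∈ H.edgeFinset, DependsOn (· ∈ A e) (e : Set V) := fun e _ ω ω' h => by
    simp only [A, Set.mem_ofPred_eq, Sym2.map_congr h]
  obtain ⟨ω, hω, hsupp⟩ := ((frequently_forall_notMem_of_dependsOn A (fun e => (e : Set V))
    H.edgeFinset hdep hprob fun e _ => hsum e).and_eventually ae_forall_mem_support).exists
  exact ⟨.mk ω fun {u v} huv => hω s(u, v) (H.mem_edgeFinset.mpr huv), hsupp⟩

section Family

variable {V ι α : Type*} [Finite V]

/-- Nearly disjoint graphs of maximum degree at most `D`, encoded on a common vertex set, such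
that every vertex is non-isolated in at most `C` of them. Here `(G i).support` plays the role of
the vertex set of the `i`-th graph. -/
structure IsNearlyDisjointFamily (G : ι → SimpleGraph V) (C : ℕ) (D : ℝ) : Prop where
  card_neighbors_le : ∀ i v, (#(neighbors (G i) v) : ℝ) ≤ D
  encard_mem_support_le : ∀ v, {i | v ∈ (G i).support}.encard ≤ C
  subsingleton_support_inter :
    Pairwise fun i j => ((G i).support ∩ (G j).support).Subsingleton

namespace IsNearlyDisjointFamily

variable {G : ι → SimpleGraph V} {C : ℕ} {D : ℝ}

lemma finite_mem_support (hG : IsNearlyDisjointFamily G C D) (v : V) :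
    {i | v ∈ (G i).support}.Finite :=
  Set.finite_of_encard_le_coe (hG.encard_mem_support_le v)

lemma card_mem_support_le (hG : IsNearlyDisjointFamily G C D) (v : V) :
    #(hG.finite_mem_support v).toFinset ≤ C := by
  rw [← Set.ncard_eq_toFinset_card _ (hG.finite_mem_support v)]
  exact ENat.toNat_le_of_le_natCast (hG.encard_mem_support_le v)

lemma sum_neighbors_iSup_le (hG : IsNearlyDisjointFamily G C D) {v : V} {f : V → ℝ} {r : ℝ}
    (hf : ∀ u, 0 ≤ f u) (hr : ∀ i, ∑ u ∈ neighbors (G i) v, f u ≤ r) (hr0 : 0 ≤ r) :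
    ∑ u ∈ neighbors (⨆ i, G i) v, f u ≤ C * r := by
  classical
  set S := (hG.finite_mem_support v).toFinset
  have hcover : ∀ u ∈ neighbors (⨆ i, G i) v,
      f u ≤ ∑ i ∈ S, (neighbors (G i) v : Set V).indicator f u := by
    intro u hu
    obtain ⟨i, hi⟩ := SimpleGraph.iSup_adj.mp (mem_neighbors.mp hu)
    have hiS : i ∈ S := by simpa [S] using ⟨u, hi⟩
    refine le_trans (le_of_eq ?_)
      (single_le_sum (fun j _ => Set.indicator_nonneg (fun u _ => hf u) u) hiS)
    rw [Set.indicator_of_mem (mem_coe.mpr (mem_neighbors.mpr hi))]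
  calc ∑ u ∈ neighbors (⨆ i, G i) v, f u
      ≤ ∑ i ∈ S, ∑ u ∈ neighbors (⨆ i, G i) v, (neighbors (G i) v : Set V).indicator f u := by
        rw [sum_comm]
        exact sum_le_sum hcover
    _ = ∑ i ∈ S, ∑ u ∈ neighbors (G i) v, f u := by
        refine sum_congr rfl fun i _ => sum_indicator_subset f fun u hu => ?_
        rw [mem_neighbors, SimpleGraph.iSup_adj]
        exact ⟨i, mem_neighbors.mp hu⟩
    _ ≤ #S * r := by simpa using sum_le_card_nsmul S _ r fun i _ => hr i
    _ ≤ C * r := by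
        have := hG.card_mem_support_le v
        gcongr

lemma card_neighbors_iSup_le (hG : IsNearlyDisjointFamily G C D) (hD : 0 ≤ D) (v : V) :
    (#(neighbors (⨆ i, G i) v) : ℝ) ≤ C * D := by
  simpa using hG.sum_neighbors_iSup_le (v := v) (f := fun _ => 1) (fun _ => zero_le_one)
    (fun i => by simpa using hG.card_neighbors_le i v) hD

end IsNearlyDisjointFamily

/-- Nonnegative color weights on the set `U` of vertices that are still to be colored. Inside each
graph of the family, the neighbors of a vertex give total weight at most `ρ` to each of its
colors. -/
structure IsWeighting [Fintype α] (G : ι → SimpleGraph V) (x : V → α → ℝ) (U : Finset V)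
    (D M K ρ : ℝ) : Prop where
  nonneg : ∀ v c, 0 ≤ x v c
  eq_zero : ∀ v ∉ U, ∀ c, x v c = 0
  sum_eq_one : ∀ v ∈ U, ∑ c, x v c = 1
  color_degree_le : ∀ i v c, 0 < x v c → ∑ u ∈ neighbors (G i) v, x u c ≤ ρ
  le_div : ∀ v c, x v c ≤ K / D
  card_support_le : ∀ v, (#{c | 0 < x v c} : ℝ) ≤ M * D

/-- `U` has a proper coloring in the union of the graphs `G i` in which every vertex gets a color
of positive weight. -/
def HasWeightedColoring (G : ι → SimpleGraph V) (x : V → α → ℝ) (U : Finset V) : Prop :=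
  ∃ φ : V → α, (∀ v ∈ U, 0 < x v (φ v)) ∧ ∀ u ∈ U, ∀ v ∈ U, (⨆ i, G i).Adj u v → φ u ≠ φ v

namespace IsWeighting

variable [Fintype α] {G : ι → SimpleGraph V} {x : V → α → ℝ} {U : Finset V} {C : ℕ}
  {D M K ρ : ℝ}

lemma mem_of_pos (hx : IsWeighting G x U D M K ρ) {v : V} {c : α} (h : 0 < x v c) : v ∈ U := by
  by_contra hv
  exact h.ne' (hx.eq_zero v hv c)

lemma sum_le_one (hx : IsWeighting G x U D M K ρ) (v : V) : ∑ c, x v c ≤ 1 := by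
  by_cases hv : v ∈ U
  · exact (hx.sum_eq_one v hv).le
  · simp [hx.eq_zero v hv]

lemma le_one (hx : IsWeighting G x U D M K ρ) (v : V) (c : α) : x v c ≤ 1 :=
  (single_le_sum (fun c _ => hx.nonneg v c) (mem_univ c)).trans (hx.sum_le_one v)

lemma sum_neighbors_iSup_le (hx : IsWeighting G x U D M K ρ)
    (hG : IsNearlyDisjointFamily G C D) (hρ : 0 ≤ ρ) {v : V} {c : α} (h : 0 < x v c) :
    ∑ u ∈ neighbors (⨆ i, G i) v, x u c ≤ C * ρ :=
  hG.sum_neighbors_iSup_le (fun u => hx.nonneg u c) (fun i => hx.color_degree_le i v c h) hρ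

theorem hasWeightedColoring_of_small [Nonempty α] (hx : IsWeighting G x U D M K ρ)
    (hG : IsNearlyDisjointFamily G C D) (hρ : 0 ≤ ρ) (hsmall : C * ρ ≤ 1 / 8) :
    HasWeightedColoring G x U := by
  classical
  let law : U → PMF α := fun v => .ofFintype (fun c => ENNReal.ofReal (x v c)) <| by
    rw [← ENNReal.ofReal_sum_of_nonneg fun c _ => hx.nonneg v c, hx.sum_eq_one v v.2,
      ENNReal.ofReal_one]
  have hlaw : ∀ v c, c ∈ (law v).support ↔ 0 < x v c := fun v c => by
    simp [law]
  obtain ⟨φ, hφ⟩ := exists_coloring_of_sum_neighbors_le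
      (H := (⨆ i, G i).induce (U : Set V)) (x := law) fun v c hc => by
    calc ∑ u ∈ neighbors ((⨆ i, G i).induce (U : Set V)) v, law u c
        = ∑ u ∈ (neighbors ((⨆ i, G i).induce (U : Set V)) v).map (Embedding.subtype _),
            ENNReal.ofReal (x u c) := by
          rw [sum_map]
          rfl
      _ ≤ ∑ u ∈ neighbors (⨆ i, G i) v, ENNReal.ofReal (x u c) := by
          refine sum_le_sum_of_subset fun u hu => ?_
          obtain ⟨u', hu', rfl⟩ := mem_map.mp hu
          simpa using hu'
      _ ≤ 1 / 8 := by
          rw [← ENNReal.ofReal_sum_of_nonneg fun u _ => hx.nonneg u c]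
          refine ENNReal.ofReal_le_of_le_toReal ?_
          refine (hx.sum_neighbors_iSup_le hG hρ ((hlaw v c).mp hc)).trans (hsmall.trans ?_)
          norm_num
  refine ⟨fun v => if hv : v ∈ U then φ ⟨v, hv⟩ else Classical.arbitrary α, fun v hv => ?_,
    fun u hu v hv huv => ?_⟩
  · simpa [hv] using (hlaw ⟨v, hv⟩ _).mp (hφ ⟨v, hv⟩)
  · have hφuv := φ.valid (v := ⟨u, hu⟩) (w := ⟨v, hv⟩) huv
    simpa only [hu, hv, dif_pos] using hφuv

end IsWeighting

end Family

section Round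

variable {V ι α : Type*}

/-- The proposals that remove `c` from `v`, where `(w, c)` stands for a proposal of the color `c`
for the vertex `w`. -/
noncomputable def blockers [Finite V] (G : ι → SimpleGraph V) (v : V) (c : α) :
    Finset (V × α) :=
  neighbors (⨆ i, G i) v ×ˢ {c}

@[simp]
lemma mem_blockers [Finite V] {G : ι → SimpleGraph V} {v : V} {c : α} {e : V × α} :
    e ∈ blockers G v c ↔ (⨆ i, G i).Adj v e.1 ∧ e.2 = c := by
  rw [blockers, mem_product, mem_neighbors, mem_singleton]

lemma sum_blockers [Finite V] {G : ι → SimpleGraph V} (f : V × α → ℝ) (v : V) (c : α) :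
    ∑ e ∈ blockers G v c, f e = ∑ w ∈ neighbors (⨆ i, G i) v, f (w, c) := by
  simp [blockers]

lemma disjoint_product_erase_product_singleton [Fintype α] [DecidableEq α] (c : α)
    (u : V) (S : Finset V) :
    Disjoint ({u} ×ˢ univ.erase c) (S ×ˢ {c}) :=
  disjoint_product.mpr (.inr (disjoint_singleton_right.mpr (notMem_erase c univ)))

variable [Fintype V] [Fintype α]

/-- The data of one round of the nibble: independently for all `v` and `c`, the color `c` is
proposed for `v` with probability `p * x v c`. -/
structure IsRound (G : ι → SimpleGraph V) (x : V → α → ℝ) (U : Finset V) (C : ℕ)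
    (D M K ρ p : ℝ) : Prop where
  family : IsNearlyDisjointFamily G C D
  weighting : IsWeighting G x U D M K ρ
  one_le_C : 1 ≤ C
  one_le_D : 1 ≤ D
  one_le_K : 1 ≤ K
  ρ_nonneg : 0 ≤ ρ
  ρ_le_one : ρ ≤ 1
  p_nonneg : 0 ≤ p
  p_le_one : p ≤ 1
  rate_le : p * (C * ρ) ≤ 1 / 2

/-- The probability of the bit `(v, c)`, which succeeds when the color `c` is proposed for `v`.
The projection onto the unit interval has no effect on the rates of a round. -/
noncomputable def rate (x : V → α → ℝ) (p : ℝ) : V × α → unitInterval := fun e =>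
  Set.projIcc 0 1 zero_le_one (p * x e.1 e.2)

/-- The probability that `c` survives at `v`. -/
noncomputable def keep (G : ι → SimpleGraph V) (x : V → α → ℝ) (p : ℝ) (v : V) (c : α) : ℝ :=
  (bits (rate x p)).real (silent (blockers G v c))

/-- The weight of `c` at `v` after a round in which `c` survives at `v`. Dividing by the survival
probability keeps the expected total weight at `v` equal to `1`. -/
noncomputable def boosted (G : ι → SimpleGraph V) (x : V → α → ℝ) (p : ℝ) (v : V) (c : α) : ℝ :=
  x v c / keep G x p v c

/-- The total weight surviving at `v`. -/
noncomputable def survivingWeight (G : ι → SimpleGraph V) (x : V → α → ℝ) (p : ℝ) (v : V) :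
    (V × α → Bool) → ℝ :=
  eventWeight univ (boosted G x p v) fun c => silent (blockers G v c)

/-- The weight of `c` on the neighbors `u` of `v` in the `i`-th graph for which some color is
proposed that is also proposed for a neighbor of `u`. -/
noncomputable def conflictWeight (G : ι → SimpleGraph V) (x : V → α → ℝ) (p : ℝ) (i : ι) (v : V)
    (c : α) : (V × α → Bool) → ℝ :=
  eventWeight (neighbors (G i) v) (boosted G x p · c) fun u =>
    ⋃ d, collision (u, d) (blockers G u d)

/-- The part of the conflict weight that is due to proposals of the color `d`. -/
noncomputable def conflictWeightAt (G : ι → SimpleGraph V) (x : V → α → ℝ) (p : ℝ) (i : ι) (v : V)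
    (c d : α) : (V × α → Bool) → ℝ :=
  eventWeight (neighbors (G i) v ×ˢ {d}) (fun e => boosted G x p e.1 c) fun e =>
    collision e (blockers G e.1 e.2)

variable {G : ι → SimpleGraph V} {x : V → α → ℝ} {U : Finset V} {C : ℕ} {D M K ρ p δ : ℝ}

lemma keep_eq_mul [DecidableEq V] (i : ι) (u : V) (c : α) :
    keep G x p u c =
      (bits (rate x p)).real (silent ((neighbors (⨆ i, G i) u \ neighbors (G i) u) ×ˢ {c})) *
        (bits (rate x p)).real (silent (neighbors (G i) u ×ˢ {c})) := by
  classical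
  have hsub : neighbors (G i) u ⊆ neighbors (⨆ i, G i) u := fun w hw => by
    rw [mem_neighbors] at hw ⊢
    exact le_iSup G i hw
  rw [← measureReal_silent_union (disjoint_product.mpr (.inl sdiff_disjoint)), ← union_product,
    sdiff_union_of_subset hsub, keep, blockers]

lemma boosted_eq_zero {v : V} {c : α} (hv : x v c = 0) : boosted G x p v c = 0 := by
  rw [boosted, hv, zero_div]

lemma boosted_nonneg (hx : ∀ v c, 0 ≤ x v c) (v : V) (c : α) : 0 ≤ boosted G x p v c :=
  div_nonneg (hx v c) measureReal_nonneg

namespace IsRound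

lemma coe_rate (h : IsRound G x U C D M K ρ p) (v : V) (c : α) :
    (rate x p (v, c) : ℝ) = p * x v c := by
  have hx := h.weighting
  rw [rate, Set.projIcc_of_mem]
  exact ⟨mul_nonneg h.p_nonneg (hx.nonneg v c),
    mul_le_one₀ h.p_le_one (hx.nonneg v c) (hx.le_one v c)⟩

lemma sum_rate_blockers_le (h : IsRound G x U C D M K ρ p) {v : V} {c : α} (hv : 0 < x v c) :
    ∑ e ∈ blockers G v c, (rate x p e : ℝ) ≤ p * (C * ρ) := by
  simp only [sum_blockers, h.coe_rate, ← mul_sum]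
  exact mul_le_mul_of_nonneg_left (h.weighting.sum_neighbors_iSup_le h.family h.ρ_nonneg hv)
    h.p_nonneg

lemma half_le_keep (h : IsRound G x U C D M K ρ p) {v : V} {c : α} (hv : 0 < x v c) :
    1 / 2 ≤ keep G x p v c := by
  refine le_trans ?_ (one_sub_sum_le_measureReal_silent _)
  linarith [h.sum_rate_blockers_le hv, h.rate_le]

lemma boosted_nonneg (h : IsRound G x U C D M K ρ p) (v : V) (c : α) : 0 ≤ boosted G x p v c :=
  NibbleColoring.boosted_nonneg h.weighting.nonneg v c

lemma boosted_mul_keep (h : IsRound G x U C D M K ρ p) (v : V) (c : α) :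
    boosted G x p v c * keep G x p v c = x v c := by
  rcases (h.weighting.nonneg v c).eq_or_lt with h0 | h0
  · rw [boosted_eq_zero h0.symm, ← h0, zero_mul]
  · exact div_mul_cancel₀ _ (by linarith [h.half_le_keep h0])

lemma boosted_le (h : IsRound G x U C D M K ρ p) (v : V) (c : α) :
    boosted G x p v c ≤ 2 * x v c := by
  rcases (h.weighting.nonneg v c).eq_or_lt with h0 | h0
  · rw [boosted_eq_zero h0.symm, ← h0, mul_zero]
  · have := mul_le_mul_of_nonneg_left (h.half_le_keep h0) (h.boosted_nonneg v c)
    rw [h.boosted_mul_keep] at this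
    linarith

lemma boosted_le_div (h : IsRound G x U C D M K ρ p) (v : V) (c : α) :
    boosted G x p v c ≤ 2 * (K / D) := by
  linarith [h.boosted_le v c, h.weighting.le_div v c]

lemma one_le_cast_C (h : IsRound G x U C D M K ρ p) : (1 : ℝ) ≤ C :=
  Nat.one_le_cast.mpr h.one_le_C

lemma tail_rate_nonneg (h : IsRound G x U C D M K ρ p) (hδ : 0 ≤ δ) :
    0 ≤ δ * D / (12 * C * K) := by
  have := h.one_le_K
  have := h.one_le_D
  positivity

lemma influence_nonneg (h : IsRound G x U C D M K ρ p) : 0 ≤ C * (2 * (K / D)) := by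
  have := h.one_le_K
  have := h.one_le_D
  positivity

lemma tail_rate_mul_le (h : IsRound G x U C D M K ρ p) (hδ1 : δ ≤ 1) :
    δ * D / (12 * C * K) * (C * (2 * (K / D))) ≤ 1 := by
  have := h.one_le_cast_C
  have := h.one_le_K
  have := h.one_le_D
  have heq : δ * D / (12 * C * K) * (C * (2 * (K / D))) = δ / 6 := by
    field_simp
    ring
  linarith

lemma exp_tail_le (h : IsRound G x U C D M K ρ p) (δ : ℝ) :
    Real.exp ((δ * D / (12 * C * K)) ^ 2 * (C * (2 * (K / D)) * 3) -
        δ * D / (12 * C * K) * δ) ≤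
      Real.exp (-(δ ^ 2 / (24 * C * K ^ 2) * D)) := by
  have := h.one_le_cast_C
  have := h.one_le_K
  have := h.one_le_D
  have heq : (δ * D / (12 * C * K)) ^ 2 * (C * (2 * (K / D)) * 3) - δ * D / (12 * C * K) * δ =
      -(δ ^ 2 / (24 * C * K) * D) := by
    field_simp
    ring
  rw [heq, Real.exp_le_exp, neg_le_neg_iff]
  have : K ≤ K ^ 2 := le_self_pow₀ h.one_le_K two_ne_zero
  gcongr

theorem measureReal_survivingWeight_le (h : IsRound G x U C D M K ρ p) (hδ : 0 ≤ δ)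
    (hδ1 : δ ≤ 1) {v : V} (hv : v ∈ U) :
    (bits (rate x p)).real {ω | survivingWeight G x p v ω ≤ 1 - δ} ≤
      Real.exp (-(δ ^ 2 / (24 * C * K ^ 2) * D)) := by
  classical
  refine (measureReal_eventWeight_le_sub_le (B := C * (2 * (K / D))) (v := 3)
    (fun c _ => h.boosted_nonneg v c) (fun c _ => dependsOn_mem_silent _) (fun e => ?_)
    h.influence_nonneg ?_ (h.tail_rate_nonneg hδ) (h.tail_rate_mul_le hδ1) ?_ δ).trans
    (h.exp_tail_le δ)
  · have hsub : ({c | e ∈ blockers G v c} : Finset α) ⊆ {e.2} := fun c hc => by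
      simp only [mem_filter_univ, mem_blockers] at hc
      simp [hc.2]
    refine (sum_le_sum_of_subset_of_nonneg hsub fun c _ _ => h.boosted_nonneg v c).trans ?_
    rw [sum_singleton]
    refine (h.boosted_le_div v e.2).trans (le_mul_of_one_le_left ?_ h.one_le_cast_C)
    exact (h.boosted_nonneg v e.2).trans (h.boosted_le_div v e.2)
  · have hterm : ∀ c, boosted G x p v c * ∑ e ∈ blockers G v c, (rate x p e : ℝ) ≤ x v c := by
      intro c
      rcases (h.weighting.nonneg v c).eq_or_lt with h0 | h0
      · rw [boosted_eq_zero h0.symm, ← h0, zero_mul]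
      · have hblock := (h.sum_rate_blockers_le h0).trans h.rate_le
        have := mul_le_mul_of_nonneg_left hblock (h.boosted_nonneg v c)
        linarith [h.boosted_le v c]
    linarith [sum_le_sum fun c (_ : c ∈ univ) => hterm c, h.weighting.sum_le_one v]
  · change 1 ≤ ∑ c, boosted G x p v c * keep G x p v c
    simp only [h.boosted_mul_keep]
    exact (h.weighting.sum_eq_one v hv).ge

lemma sum_rate_others_le [DecidableEq α] (h : IsRound G x U C D M K ρ p) (u : V) (c : α) :
    ∑ e ∈ {u} ×ˢ univ.erase c, (rate x p e : ℝ) ≤ 1 := by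
  simp only [singleton_product, sum_map, Embedding.coeFn_mk, h.coe_rate, ← mul_sum]
  refine mul_le_one₀ h.p_le_one (sum_nonneg fun d _ => h.weighting.nonneg u d) ?_
  exact (sum_le_sum_of_subset_of_nonneg (erase_subset _ _) fun d _ _ =>
    h.weighting.nonneg u d).trans (h.weighting.sum_le_one u)

lemma measureReal_silent_others_le [DecidableEq α] (h : IsRound G x U C D M K ρ p) {u : V}
    (hu : u ∈ U) (c : α) :
    (bits (rate x p)).real (silent ({u} ×ˢ univ.erase c)) ≤ Real.exp (-p + p * (K / D)) := by
  refine (measureReal_silent_le_exp _).trans (Real.exp_le_exp.mpr ?_)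
  simp only [singleton_product, sum_map, Embedding.coeFn_mk, h.coe_rate, ← mul_sum]
  have hsum := sum_erase_add univ (x u) (mem_univ c)
  rw [h.weighting.sum_eq_one u hu] at hsum
  rw [eq_sub_of_add_eq hsum]
  linarith [mul_le_mul_of_nonneg_left (h.weighting.le_div u c) h.p_nonneg]

lemma one_sub_le_measureReal_silent_inner (h : IsRound G x U C D M K ρ p) (i : ι) {u : V} {c : α}
    (hu : 0 < x u c) :
    1 - p * ρ ≤ (bits (rate x p)).real (silent (neighbors (G i) u ×ˢ {c})) := by
  refine le_trans ?_ (one_sub_sum_le_measureReal_silent _)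
  simp only [product_singleton, sum_map, Embedding.coeFn_mk, h.coe_rate, ← mul_sum]
  linarith [mul_le_mul_of_nonneg_left (h.weighting.color_degree_le i u c hu) h.p_nonneg]

lemma p_mul_ρ_le (h : IsRound G x U C D M K ρ p) : p * ρ ≤ 1 / 2 := by
  refine le_trans ?_ h.rate_le
  exact mul_le_mul_of_nonneg_left (le_mul_of_one_le_left h.ρ_nonneg h.one_le_cast_C) h.p_nonneg

end IsRound

section Idle

variable [DecidableEq V] [DecidableEq α]

/-- The proposals at `u` of colors other than `c`, and those that remove `c` from `u` by an edge
outside of the `i`-th graph. -/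
noncomputable def outerBlockers (G : ι → SimpleGraph V) (i : ι) (c : α) (u : V) :
    Finset (V × α) :=
  {u} ×ˢ univ.erase c ∪ (neighbors (⨆ i, G i) u \ neighbors (G i) u) ×ˢ {c}

/-- The weight of `c` on the neighbors of `v` in the `i`-th graph for which no other color is
proposed and where `c` is not removed by an edge outside of this graph. -/
noncomputable def idleWeight (G : ι → SimpleGraph V) (x : V → α → ℝ) (p : ℝ) (i : ι) (v : V)
    (c : α) : (V × α → Bool) → ℝ :=
  eventWeight (neighbors (G i) v) (boosted G x p · c) fun u => silent (outerBlockers G i c u)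

lemma mem_outerBlockers {i : ι} {c d : α} {u w : V} :
    (w, d) ∈ outerBlockers G i c u ↔
      w = u ∧ d ≠ c ∨ ((⨆ i, G i).Adj u w ∧ ¬ (G i).Adj u w) ∧ d = c := by
  simp [outerBlockers, -product_singleton, -singleton_product]

end Idle

namespace IsRound

variable [DecidableEq V] [DecidableEq α]

/- Every proposal `(w, c)` concerns at most one of the neighbors of `v` in each of the other graphs
containing `w`, because the graphs are nearly disjoint. -/
lemma card_filter_mem_outerBlockers_le (h : IsRound G x U C D M K ρ p) (i : ι) (v : V) (c : α)
    (e : V × α) : #{u ∈ neighbors (G i) v | e ∈ outerBlockers G i c u} ≤ C := by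
  obtain ⟨w, d⟩ := e
  have : Nonempty ι := ⟨i⟩
  by_cases hd : d = c
  · have hex : ∀ u ∈ {u ∈ neighbors (G i) v | (w, d) ∈ outerBlockers G i c u},
        ∃ j, j ≠ i ∧ (G j).Adj u w := by
      intro u hu
      simp only [mem_filter, mem_outerBlockers, hd, ne_eq, not_true_eq_false, and_false, false_or,
        and_true] at hu
      obtain ⟨-, hj, hi⟩ := hu
      obtain ⟨j, hj⟩ := SimpleGraph.iSup_adj.mp hj
      exact ⟨j, fun hji => hi (hji ▸ hj), hj⟩
    choose! J hJi hJ using hex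
    refine (card_le_card_of_injOn J (fun u hu => ?_) fun u hu u' hu' huu' => ?_).trans
      (h.family.card_mem_support_le w)
    · simpa using ⟨u, (hJ u hu).symm⟩
    · have hsupp : ∀ u ∈ {u ∈ neighbors (G i) v | (w, d) ∈ outerBlockers G i c u},
          u ∈ (G i).support := fun u hu => ⟨v, (mem_neighbors.mp (mem_filter.mp hu).1).symm⟩
      exact h.family.subsingleton_support_inter (hJi u hu).symm ⟨hsupp u hu, w, hJ u hu⟩
        ⟨hsupp u' hu', w, huu' ▸ hJ u' hu'⟩
  · refine (card_le_one.mpr fun u hu u' hu' => ?_).trans h.one_le_C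
    simp only [mem_filter, mem_outerBlockers, hd, and_false, or_false] at hu hu'
    rw [← hu.2.1, ← hu'.2.1]

lemma boosted_mul_sum_rate_outerBlockers_le (h : IsRound G x U C D M K ρ p) (i : ι) (u : V)
    (c : α) : boosted G x p u c * ∑ e ∈ outerBlockers G i c u, (rate x p e : ℝ) ≤ 3 * x u c := by
  rcases (h.weighting.nonneg u c).eq_or_lt with h0 | h0
  · rw [boosted_eq_zero h0.symm, ← h0, zero_mul, mul_zero]
  · have hneighbors : ∑ e ∈ (neighbors (⨆ i, G i) u \ neighbors (G i) u) ×ˢ {c},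
        (rate x p e : ℝ) ≤ 1 / 2 :=
      (sum_le_sum_of_subset_of_nonneg (product_subset_product_left sdiff_subset) fun e _ _ =>
        (rate x p e).2.1).trans ((h.sum_rate_blockers_le h0).trans h.rate_le)
    have hsum : ∑ e ∈ outerBlockers G i c u, (rate x p e : ℝ) ≤ 3 / 2 := by
      rw [outerBlockers, sum_union (disjoint_product_erase_product_singleton c u _)]
      linarith [h.sum_rate_others_le u c]
    have := mul_le_mul_of_nonneg_left hsum (h.boosted_nonneg u c)
    linarith [h.boosted_le u c]

lemma boosted_mul_measureReal_outerBlockers_le (h : IsRound G x U C D M K ρ p) (i : ι) (u : V)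
    (c : α) :
    boosted G x p u c * (bits (rate x p)).real (silent (outerBlockers G i c u)) ≤
      x u c * (Real.exp (-p + p * (K / D)) / (1 - p * ρ)) := by
  rcases (h.weighting.nonneg u c).eq_or_lt with h0 | h0
  · rw [boosted_eq_zero h0.symm, ← h0, zero_mul, zero_mul]
  have hinner := h.one_sub_le_measureReal_silent_inner i h0
  have hothers := h.measureReal_silent_others_le (h.weighting.mem_of_pos h0) c
  have hx := h.boosted_mul_keep u c
  rw [keep_eq_mul i] at hx
  rw [outerBlockers, measureReal_silent_union (disjoint_product_erase_product_singleton c u _),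
    ← mul_div_assoc, le_div_iff₀ (by linarith [h.p_mul_ρ_le])]
  set others := (bits (rate x p)).real (silent ({u} ×ˢ univ.erase c))
  set outer := (bits (rate x p)).real
    (silent ((neighbors (⨆ i, G i) u \ neighbors (G i) u) ×ˢ {c}))
  set inner := (bits (rate x p)).real (silent (neighbors (G i) u ×ˢ {c}))
  have : 0 ≤ others := measureReal_nonneg
  have : 0 ≤ outer := measureReal_nonneg
  have hboosted := h.boosted_nonneg u c
  calc boosted G x p u c * (others * outer) * (1 - p * ρ)
      ≤ boosted G x p u c * (others * outer) * inner := by gcongr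
    _ = x u c * others := by
        rw [← hx]
        ring
    _ ≤ x u c * Real.exp (-p + p * (K / D)) := by gcongr

theorem measureReal_le_idleWeight_le (h : IsRound G x U C D M K ρ p) (hδ : 0 ≤ δ) (hδ1 : δ ≤ 1)
    (i : ι) {v : V} {c : α} (hv : 0 < x v c) :
    (bits (rate x p)).real
        {ω | ρ * (Real.exp (-p + p * (K / D)) / (1 - p * ρ)) + δ ≤ idleWeight G x p i v c ω} ≤
      Real.exp (-(δ ^ 2 / (24 * C * K ^ 2) * D)) := by
  have hdeg := h.weighting.color_degree_le i v c hv
  have hD := h.one_le_D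
  have hK := h.one_le_K
  refine (measureReal_add_le_eventWeight_le (B := C * (2 * (K / D))) (v := 3)
    (fun u _ => h.boosted_nonneg u c) (fun u _ => dependsOn_mem_silent _) (fun e => ?_)
    h.influence_nonneg ?_ (h.tail_rate_nonneg hδ) (h.tail_rate_mul_le hδ1) ?_ δ).trans
    (h.exp_tail_le δ)
  · refine (sum_le_card_nsmul _ _ (2 * (K / D)) fun u _ => h.boosted_le_div u c).trans ?_
    rw [nsmul_eq_mul]
    have := h.card_filter_mem_outerBlockers_le i v c e
    gcongr
  · have := sum_le_sum fun u (_ : u ∈ neighbors (G i) v) =>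
      h.boosted_mul_sum_rate_outerBlockers_le i u c
    rw [← mul_sum] at this
    linarith [h.ρ_le_one]
  · refine (sum_le_sum fun u _ => h.boosted_mul_measureReal_outerBlockers_le i u c).trans ?_
    rw [← sum_mul]
    have := h.p_mul_ρ_le
    exact mul_le_mul_of_nonneg_right hdeg (div_nonneg (Real.exp_pos _).le (by linarith))

end IsRound

section Conflict

lemma conflictWeight_le_sum (hx : ∀ v c, 0 ≤ x v c) (i : ι) (v : V) (c : α) (ω : V × α → Bool) :
    conflictWeight G x p i v c ω ≤ ∑ d, conflictWeightAt G x p i v c d ω := by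
  simp only [conflictWeight, conflictWeightAt, eventWeight, sum_product, sum_singleton]
  rw [sum_comm]
  refine sum_le_sum fun u _ => ?_
  have hterm : ∀ d, 0 ≤
      (collision (u, d) (blockers G u d)).indicator (fun _ => boosted G x p u c) ω :=
    fun d => Set.indicator_nonneg (fun _ _ => boosted_nonneg hx u c) ω
  by_cases hω : ω ∈ ⋃ d, collision (u, d) (blockers G u d)
  · obtain ⟨d, hd⟩ := Set.mem_iUnion.mp hω
    rw [Set.indicator_of_mem hω]
    refine le_trans (le_of_eq ?_) (single_le_sum (fun d _ => hterm d) (mem_univ d))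
    rw [Set.indicator_of_mem hd]
  · rw [Set.indicator_of_notMem hω]
    exact sum_nonneg fun d _ => hterm d

lemma dependsOn_conflictWeightAt (i : ι) (v : V) (c d : α) :
    DependsOn (conflictWeightAt G x p i v c d) {e | e.2 = d} := by
  refine dependsOn_eventWeight fun e he => (dependsOn_mem_collision e _).mono ?_
  have hed : e.2 = d := mem_singleton.mp (mem_product.mp he).2
  refine Set.insert_subset hed fun w hw => ?_
  exact (mem_blockers.mp hw).2.trans hed

end Conflict

namespace IsRound

lemma mul_boosted_le (h : IsRound G x U C D M K ρ p) (v : V) (c : α) :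
    D / (8 * K ^ 2) * boosted G x p v c ≤ 1 / (4 * K) := by
  have hK := h.one_le_K
  have hD := h.one_le_D
  refine (mul_le_mul_of_nonneg_left (h.boosted_le_div v c) (by positivity)).trans (le_of_eq ?_)
  field_simp
  norm_num

lemma sum_rate_mul_boosted_le (h : IsRound G x U C D M K ρ p) (i : ι) (v : V) (c d : α) :
    ∑ e ∈ neighbors (G i) v ×ˢ {d}, rate x p e * (D / (8 * K ^ 2) * boosted G x p e.1 c) ≤
      1 / 4 := by
  have hK := h.one_le_K
  have hD := h.one_le_D
  have hterm : ∀ e ∈ neighbors (G i) v ×ˢ {d},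
      rate x p e * (D / (8 * K ^ 2) * boosted G x p e.1 c) ≤ 1 / (4 * D) := fun e _ => by
    have hrate : (rate x p e : ℝ) ≤ K / D := by
      rw [← Prod.eta e, h.coe_rate]
      exact (mul_le_of_le_one_left (h.weighting.nonneg _ _) h.p_le_one).trans
        (h.weighting.le_div _ _)
    have := h.boosted_nonneg e.1 c
    refine (mul_le_mul hrate (h.mul_boosted_le e.1 c) (by positivity) (by positivity)).trans
      (le_of_eq ?_)
    field_simp
  refine (sum_le_card_nsmul _ _ _ hterm).trans ?_
  rw [card_product, card_singleton, mul_one, nsmul_eq_mul]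
  calc _ ≤ D * (1 / (4 * D)) := by
        have := h.family.card_neighbors_le i v
        gcongr
    _ = 1 / 4 := by field_simp

lemma integral_exp_mul_conflictWeightAt_le (h : IsRound G x U C D M K ρ p) (i : ι) (v : V)
    (c d : α) :
    ∫ ω, Real.exp (D / (8 * K ^ 2) * conflictWeightAt G x p i v c d ω) ∂bits (rate x p) ≤
      Real.exp (D / (8 * K ^ 2) *
        (3 * p ^ 2 * C * ρ * ∑ u ∈ neighbors (G i) v, boosted G x p u c * x u d)) := by
  have hK := h.one_le_K
  have hD := h.one_le_D
  have hb0 : ∀ u, 0 ≤ D / (8 * K ^ 2) * boosted G x p u c := fun u =>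
    mul_nonneg (by positivity) (h.boosted_nonneg u c)
  have hb : ∀ u, D / (8 * K ^ 2) * boosted G x p u c ≤ 1 / 4 := fun u =>
    (h.mul_boosted_le u c).trans (by gcongr; linarith)
  simp only [conflictWeightAt, mul_eventWeight]
  refine (integral_exp_eventWeight_collision_le
    (b := fun e : V × α => D / (8 * K ^ 2) * boosted G x p e.1 c) (fun e he => ?_)
    (fun e : V × α => hb0 e.1) (fun e : V × α => hb e.1) (h.sum_rate_mul_boosted_le i v c d)).trans
    (Real.exp_le_exp.mpr ?_)
  · exact (⨆ i, G i).irrefl (mem_blockers.mp he).1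
  rw [sum_product, mul_sum, mul_sum, mul_sum]
  refine sum_le_sum fun u _ => ?_
  rw [sum_singleton, h.coe_rate]
  set b := D / (8 * K ^ 2) * boosted G x p u c with hbu
  have : 0 ≤ b := hb0 u
  rcases (h.weighting.nonneg u d).eq_or_lt with h0 | h0
  · simp [← h0]
  · have := h.p_nonneg
    calc 3 * (b * (p * x u d * ∑ w ∈ blockers G u d, (rate x p w : ℝ)))
        ≤ 3 * (b * (p * x u d * (p * (C * ρ)))) := by
          have := h.sum_rate_blockers_le h0
          gcongr
      _ = _ := by
          rw [hbu]
          ring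

lemma integral_exp_mul_conflictWeight_le (h : IsRound G x U C D M K ρ p) (i : ι) {v : V} {c : α}
    (hv : 0 < x v c) :
    ∫ ω, Real.exp (D / (8 * K ^ 2) * conflictWeight G x p i v c ω) ∂bits (rate x p) ≤
      Real.exp (D / (8 * K ^ 2) * (6 * C * p ^ 2 * ρ ^ 2)) := by
  have hs0 : 0 ≤ D / (8 * K ^ 2) := div_nonneg (by linarith [h.one_le_D]) (by positivity)
  set s : ℝ := D / (8 * K ^ 2)
  have := h.p_nonneg
  have := h.ρ_nonneg
  calc _ ≤ ∫ ω, ∏ d, Real.exp (s * conflictWeightAt G x p i v c d ω) ∂bits (rate x p) := by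
        refine integral_mono integrable_bits integrable_bits fun ω => ?_
        rw [← Real.exp_sum, ← mul_sum]
        have := conflictWeight_le_sum (G := G) (p := p) h.weighting.nonneg i v c ω
        gcongr
    _ = ∏ d, ∫ ω, Real.exp (s * conflictWeightAt G x p i v c d ω) ∂bits (rate x p) := by
        refine integral_prod_of_dependsOn (S := fun d => {e | e.2 = d}) univ
          (fun d ω ω' hω => ?_) fun d d' hdd => ?_
        · simp only [dependsOn_conflictWeightAt i v c d hω]
        · exact Set.disjoint_left.mpr fun e hd hd' => hdd (hd.symm.trans hd')
    _ ≤ ∏ d, Real.exp (s * (3 * p ^ 2 * C * ρ *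
          ∑ u ∈ neighbors (G i) v, boosted G x p u c * x u d)) :=
        prod_le_prod (fun d _ => integral_nonneg fun ω => (Real.exp_pos _).le)
          fun d _ => h.integral_exp_mul_conflictWeightAt_le i v c d
    _ = Real.exp (s * (3 * p ^ 2 * C * ρ *
          ∑ u ∈ neighbors (G i) v, boosted G x p u c * ∑ d, x u d)) := by
        rw [← Real.exp_sum, ← mul_sum, ← mul_sum, sum_comm]
        simp only [mul_sum]
    _ ≤ Real.exp (s * (3 * p ^ 2 * C * ρ * (2 * ρ))) := by
        gcongr
        calc _ ≤ ∑ u ∈ neighbors (G i) v, 2 * x u c := by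
              refine sum_le_sum fun u _ => ?_
              exact (mul_le_of_le_one_right (h.boosted_nonneg u c)
                (h.weighting.sum_le_one u)).trans (h.boosted_le u c)
          _ ≤ 2 * ρ := by
              rw [← mul_sum]
              linarith [h.weighting.color_degree_le i v c hv]
    _ = _ := by ring_nf

theorem measureReal_le_conflictWeight_le (h : IsRound G x U C D M K ρ p) (hδ : 0 ≤ δ)
    (hδ1 : δ ≤ 1) (i : ι) {v : V} {c : α} (hv : 0 < x v c) :
    (bits (rate x p)).real
        {ω | 6 * C * p ^ 2 * ρ ^ 2 + δ ≤ conflictWeight G x p i v c ω} ≤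
      Real.exp (-(δ ^ 2 / (24 * C * K ^ 2) * D)) := by
  have hC := h.one_le_cast_C
  have hK := h.one_le_K
  have hD := h.one_le_D
  refine (measure_ge_le_exp_mul_mgf (t := D / (8 * K ^ 2)) _ (by positivity)
    integrable_bits).trans ?_
  refine (mul_le_mul_of_nonneg_left (h.integral_exp_mul_conflictWeight_le i hv)
    (Real.exp_pos _).le).trans ?_
  rw [← Real.exp_add, Real.exp_le_exp]
  have hδ2 : δ ^ 2 ≤ δ := pow_le_of_le_one hδ hδ1 two_ne_zero
  have hexponent : δ ^ 2 / (24 * C * K ^ 2) * D ≤ D / (8 * K ^ 2) * δ := by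
    calc _ ≤ δ / (8 * K ^ 2) * D := by
          gcongr
          linarith
      _ = _ := by ring
  linarith

end IsRound

end Round

section Ball

lemma card_biUnion_le_mul {κ τ : Type*} [DecidableEq τ] {s : Finset κ} {F : κ → Finset τ} {r : ℝ}
    (h : ∀ k ∈ s, (#(F k) : ℝ) ≤ r) : (#(s.biUnion F) : ℝ) ≤ #s * r := by
  calc (#(s.biUnion F) : ℝ) ≤ ∑ k ∈ s, (#(F k) : ℝ) := mod_cast card_biUnion_le
    _ ≤ #s * r := by simpa using sum_le_card_nsmul _ _ _ h

variable {V : Type*} [Finite V] [DecidableEq V]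

/-- The vertices at distance at most one from `v`. -/
noncomputable def closedNeighbors (H : SimpleGraph V) (v : V) : Finset V :=
  insert v (neighbors H v)

/-- The vertices at distance at most two from `v`. -/
noncomputable def ball (H : SimpleGraph V) (v : V) : Finset V :=
  (closedNeighbors H v).biUnion (closedNeighbors H)

variable {H : SimpleGraph V} {d : ℝ}

lemma mem_closedNeighbors_comm {u v : V} :
    u ∈ closedNeighbors H v ↔ v ∈ closedNeighbors H u := by
  simp only [closedNeighbors, mem_insert, mem_neighbors, H.adj_comm v u, eq_comm (a := u)]

lemma mem_ball_comm {u v : V} : u ∈ ball H v ↔ v ∈ ball H u := by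
  simp only [ball, mem_biUnion, mem_closedNeighbors_comm (u := u),
    mem_closedNeighbors_comm (v := v), and_comm]

lemma mem_ball_of_adj {u v : V} (h : H.Adj v u) : u ∈ ball H v :=
  mem_biUnion.mpr ⟨v, mem_insert_self _ _, mem_insert_of_mem (mem_neighbors.mpr h)⟩

lemma mem_ball_of_adj_adj {u v w : V} (h : H.Adj v u) (h' : H.Adj u w) : w ∈ ball H v :=
  mem_biUnion.mpr ⟨u, mem_insert_of_mem (mem_neighbors.mpr h),
    mem_insert_of_mem (mem_neighbors.mpr h')⟩

lemma card_ball_le (hd : ∀ v, (#(neighbors H v) : ℝ) ≤ d) (v : V) :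
    (#(ball H v) : ℝ) ≤ (1 + d) ^ 2 := by
  have hclosed : ∀ w, (#(closedNeighbors H w) : ℝ) ≤ 1 + d := fun w => by
    have : (#(closedNeighbors H w) : ℝ) ≤ #(neighbors H w) + 1 := mod_cast card_insert_le _ _
    linarith [hd w]
  have : 0 ≤ d := (Nat.cast_nonneg _).trans (hd v)
  calc (#(ball H v) : ℝ) ≤ #(closedNeighbors H v) * (1 + d) :=
        card_biUnion_le_mul fun w _ => hclosed w
    _ ≤ (1 + d) * (1 + d) := by
        gcongr
        exact hclosed v
    _ = (1 + d) ^ 2 := (sq _).symm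

lemma card_biUnion_ball_le (hd : ∀ v, (#(neighbors H v) : ℝ) ≤ d) (v : V) :
    (#((ball H v).biUnion (ball H)) : ℝ) ≤ (1 + d) ^ 4 := by
  calc (#((ball H v).biUnion (ball H)) : ℝ) ≤ #(ball H v) * (1 + d) ^ 2 :=
        card_biUnion_le_mul fun w _ => card_ball_le hd w
    _ ≤ (1 + d) ^ 2 * (1 + d) ^ 2 := by
        gcongr
        exact card_ball_le hd v
    _ = (1 + d) ^ 4 := by ring

end Ball

section Outcome

variable {V ι α : Type*} [Fintype V] [Fintype α] {G : ι → SimpleGraph V}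
  {x : V → α → ℝ} {U : Finset V} {C : ℕ} {D M K ρ p δ : ℝ}

namespace IsRound

/-- The indices of the bad events at the vertex `v`. -/
noncomputable def badIndicesAt (h : IsRound G x U C D M K ρ p) (v : V) :
    Finset (Option (ι × α)) :=
  insertNone ((h.family.finite_mem_support v).toFinset ×ˢ ({c | 0 < x v c} : Finset α))

lemma some_mem_badIndicesAt (h : IsRound G x U C D M K ρ p) {i : ι} {v : V} {c : α} :
    some (i, c) ∈ h.badIndicesAt v ↔ v ∈ (G i).support ∧ 0 < x v c := by
  simp [badIndicesAt]

lemma card_badIndicesAt_le (h : IsRound G x U C D M K ρ p) (v : V) :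
    (#(h.badIndicesAt v) : ℝ) ≤ 1 + C * (M * D) := by
  rw [badIndicesAt, card_insertNone, card_product]
  push_cast
  rw [add_comm]
  have := h.family.card_mem_support_le v
  have := h.weighting.card_support_le v
  gcongr

lemma ae_forall_pos (h : IsRound G x U C D M K ρ p) :
    ∀ᵐ ω ∂bits (rate x p), ∀ v c, ω (v, c) = true → 0 < x v c := by
  simp only [ae_all_iff]
  intro v c
  rcases (h.weighting.nonneg v c).eq_or_lt with h0 | h0
  · have hnull : (bits (rate x p)).real (success (v, c)) = 0 := by
      rw [measureReal_success, h.coe_rate, ← h0, mul_zero]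
    filter_upwards [measure_eq_zero_iff_ae_notMem.mp
      ((measureReal_eq_zero_iff).mp hnull)] with ω hω hvc
    exact (hω hvc).elim
  · exact .of_forall fun _ _ => h0

end IsRound

variable [DecidableEq V]

lemma dependsOn_survivingWeight (v : V) :
    DependsOn (survivingWeight G x p v) {e | e.1 ∈ ball (⨆ i, G i) v} :=
  dependsOn_eventWeight fun c _ => (dependsOn_mem_silent (blockers G v c)).mono fun _ he =>
    mem_ball_of_adj (mem_blockers.mp he).1

lemma dependsOn_conflictWeight (i : ι) (v : V) (c : α) :
    DependsOn (conflictWeight G x p i v c) {e | e.1 ∈ ball (⨆ i, G i) v} := by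
  refine dependsOn_eventWeight fun u hu ω ω' hω => ?_
  have hvu : (⨆ i, G i).Adj v u := le_iSup G i (mem_neighbors.mp hu)
  simp only [Set.mem_iUnion, eq_iff_iff]
  refine exists_congr fun d => iff_of_eq (dependsOn_mem_collision (u, d) _ fun e he => hω e ?_)
  rcases he with rfl | he
  · exact mem_ball_of_adj hvu
  · exact mem_ball_of_adj_adj hvu (mem_blockers.mp he).1

open scoped Classical in
lemma IsRound.card_filter_badIndices_le (h : IsRound G x U C D M K ρ p) (v : V) :
    (#{l ∈ U.sigma h.badIndicesAt |
      ¬ Disjoint ({e | e.1 ∈ ball (⨆ i, G i) v} : Set (V × α))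
        {e | e.1 ∈ ball (⨆ i, G i) l.1}} : ℝ) ≤ (1 + C * D) ^ 4 * (1 + C * (M * D)) := by
  have hD := h.one_le_D
  have : 0 ≤ 1 + C * (M * D) := (Nat.cast_nonneg _).trans (h.card_badIndicesAt_le v)
  have hsub : {l ∈ U.sigma h.badIndicesAt |
      ¬ Disjoint ({e | e.1 ∈ ball (⨆ i, G i) v} : Set (V × α))
        {e | e.1 ∈ ball (⨆ i, G i) l.1}} ⊆
      ((ball (⨆ i, G i) v).biUnion (ball (⨆ i, G i))).sigma h.badIndicesAt := by
    intro l hl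
    obtain ⟨hl, hmeet⟩ := mem_filter.mp hl
    obtain ⟨e, hev, hel⟩ := Set.not_disjoint_iff.mp hmeet
    exact mem_sigma.mpr ⟨mem_biUnion.mpr ⟨e.1, hev, mem_ball_comm.mp hel⟩, (mem_sigma.mp hl).2⟩
  calc _ ≤ ∑ w ∈ (ball (⨆ i, G i) v).biUnion (ball (⨆ i, G i)), (#(h.badIndicesAt w) : ℝ) := by
        exact_mod_cast (card_le_card hsub).trans_eq (card_sigma _ _)
    _ ≤ #((ball (⨆ i, G i) v).biUnion (ball (⨆ i, G i))) * (1 + C * (M * D)) := by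
        rw [← nsmul_eq_mul]
        exact sum_le_card_nsmul _ _ _ fun w _ => h.card_badIndicesAt_le w
    _ ≤ _ := by
        have := card_biUnion_ball_le (h.family.card_neighbors_iSup_le (by linarith)) v
        gcongr

variable [DecidableEq α]

lemma dependsOn_idleWeight (i : ι) (v : V) (c : α) :
    DependsOn (idleWeight G x p i v c) {e | e.1 ∈ ball (⨆ i, G i) v} := by
  refine dependsOn_eventWeight fun u hu => (dependsOn_mem_silent _).mono ?_
  have hvu : (⨆ i, G i).Adj v u := le_iSup G i (mem_neighbors.mp hu)
  rintro ⟨w, d⟩ he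
  rcases mem_outerBlockers.mp he with ⟨rfl, -⟩ | ⟨⟨huw, -⟩, -⟩
  · exact mem_ball_of_adj hvu
  · exact mem_ball_of_adj_adj hvu huw

/-- The events to be avoided in a round: at a vertex, the loss of too much weight; at a vertex, a
graph and a color, too much weight on neighbors that may stay uncolored. -/
def badEvent (G : ι → SimpleGraph V) (x : V → α → ℝ) (C : ℕ) (D K ρ p δ : ℝ) :
    (Σ _ : V, Option (ι × α)) → Set (V × α → Bool)
  | ⟨v, none⟩ => {ω | survivingWeight G x p v ω ≤ 1 - δ}
  | ⟨v, some (i, c)⟩ =>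
    {ω | ρ * (Real.exp (-p + p * (K / D)) / (1 - p * ρ)) + δ ≤ idleWeight G x p i v c ω} ∪
      {ω | 6 * C * p ^ 2 * ρ ^ 2 + δ ≤ conflictWeight G x p i v c ω}

lemma dependsOn_mem_badEvent (k : Σ _ : V, Option (ι × α)) :
    DependsOn (· ∈ badEvent G x C D K ρ p δ k) {e | e.1 ∈ ball (⨆ i, G i) k.1} := by
  obtain ⟨v, _ | ⟨i, c⟩⟩ := k <;> intro ω ω' h
  · simp only [badEvent, Set.mem_ofPred_eq, dependsOn_survivingWeight v h]
  · simp only [badEvent, Set.mem_union, Set.mem_ofPred_eq, dependsOn_idleWeight i v c h,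
      dependsOn_conflictWeight i v c h]

/-- The outcomes of a round in which all proposed colors are allowed, no vertex of `U` loses more
than `δ` of its weight, and the neighbors that may stay uncolored inside one graph have total
weight at most `r`. -/
structure IsGoodOutcome (G : ι → SimpleGraph V) (x : V → α → ℝ) (U : Finset V) (p δ r : ℝ)
    (ω : V × α → Bool) : Prop where
  pos_of_eq_true : ∀ v c, ω (v, c) = true → 0 < x v c
  lt_survivingWeight : ∀ v ∈ U, 1 - δ < survivingWeight G x p v ω
  idleWeight_add_conflictWeight_le :
    ∀ i v c, 0 < x v c → idleWeight G x p i v c ω + conflictWeight G x p i v c ω ≤ r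

namespace IsRound

lemma measureReal_badEvent_le (h : IsRound G x U C D M K ρ p) (hδ : 0 ≤ δ) (hδ1 : δ ≤ 1)
    {k : Σ _ : V, Option (ι × α)} (hk : k ∈ U.sigma h.badIndicesAt) :
    (bits (rate x p)).real (badEvent G x C D K ρ p δ k) ≤
      2 * Real.exp (-(δ ^ 2 / (24 * C * K ^ 2) * D)) := by
  obtain ⟨v, _ | ⟨i, c⟩⟩ := k
  · refine (h.measureReal_survivingWeight_le hδ hδ1 (mem_sigma.mp hk).1).trans ?_
    exact le_mul_of_one_le_left (Real.exp_pos _).le one_le_two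
  · have hv : 0 < x v c := (h.some_mem_badIndicesAt.mp (mem_sigma.mp hk).2).2
    rw [two_mul]
    exact (measureReal_union_le _ _).trans
      (add_le_add (h.measureReal_le_idleWeight_le hδ hδ1 i hv)
        (h.measureReal_le_conflictWeight_le hδ hδ1 i hv))

lemma isGoodOutcome_of_forall_notMem_badEvent (h : IsRound G x U C D M K ρ p) (hδ : 0 ≤ δ)
    {ω : V × α → Bool} (hpos : ∀ v c, ω (v, c) = true → 0 < x v c)
    (hω : ∀ k ∈ U.sigma h.badIndicesAt, ω ∉ badEvent G x C D K ρ p δ k) :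
    IsGoodOutcome G x U p δ (ρ * (Real.exp (-p + p * (K / D)) / (1 - p * ρ)) +
      6 * C * p ^ 2 * ρ ^ 2 + 2 * δ) ω := by
  refine ⟨hpos, fun v hv => ?_, fun i v c hvc => ?_⟩
  · exact not_le.mp (hω ⟨v, none⟩ (mem_sigma.mpr ⟨hv, none_mem_insertNone⟩))
  · by_cases hi : v ∈ (G i).support
    · have hgood := hω ⟨v, some (i, c)⟩
        (mem_sigma.mpr ⟨h.weighting.mem_of_pos hvc, h.some_mem_badIndicesAt.mpr ⟨hi, hvc⟩⟩)
      simp only [badEvent, Set.mem_union, Set.mem_ofPred_eq, not_or, not_le] at hgood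
      linarith [hgood.1, hgood.2]
    · have hnone : neighbors (G i) v = ∅ :=
        eq_empty_of_forall_notMem fun u hu => hi ⟨u, mem_neighbors.mp hu⟩
      have := h.ρ_nonneg
      have : 0 ≤ 1 - p * ρ := by linarith [h.p_mul_ρ_le]
      simp only [idleWeight, conflictWeight, eventWeight, hnone, sum_empty, add_zero]
      positivity

theorem exists_isGoodOutcome (h : IsRound G x U C D M K ρ p) (hδ : 0 ≤ δ) (hδ1 : δ ≤ 1)
    (hM : 0 ≤ M)
    (hlll : (1 + C * D) ^ 4 * (1 + C * (M * D)) *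
      (2 * Real.exp (-(δ ^ 2 / (24 * C * K ^ 2) * D))) ≤ 1 / 4) :
    ∃ ω, IsGoodOutcome G x U p δ (ρ * (Real.exp (-p + p * (K / D)) / (1 - p * ρ)) +
      6 * C * p ^ 2 * ρ ^ 2 + 2 * δ) ω := by
  classical
  have hD := h.one_le_D
  set q := 2 * Real.exp (-(δ ^ 2 / (24 * C * K ^ 2) * D))
  have hq0 : 0 ≤ q := by positivity
  have hprob : ∀ k ∈ U.sigma h.badIndicesAt,
      (bits (rate x p)).real (badEvent G x C D K ρ p δ k) ≤ q :=
    fun k hk => h.measureReal_badEvent_le hδ hδ1 hk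
  have hq : q ≤ 1 / 4 := by
    refine le_trans (le_mul_of_one_le_left hq0 (one_le_mul_of_one_le_of_one_le ?_ ?_)) hlll
    · exact one_le_pow₀ (le_add_of_nonneg_right (by positivity))
    · exact le_add_of_nonneg_right (by positivity)
  have hlocal := frequently_forall_notMem_of_dependsOn (badEvent G x C D K ρ p δ)
    (fun k => {e | e.1 ∈ ball (⨆ i, G i) k.1}) (U.sigma h.badIndicesAt)
    (fun k _ => dependsOn_mem_badEvent k) (fun k hk => (hprob k hk).trans hq) fun k _ => by
      refine (sum_le_card_nsmul _ _ q fun l hl => hprob l (mem_filter.mp hl).1).trans ?_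
      rw [nsmul_eq_mul]
      refine le_trans ?_ hlll
      have := h.card_filter_badIndices_le k.1
      gcongr
  obtain ⟨ω, hω, hpos⟩ := (hlocal.and_eventually h.ae_forall_pos).exists
  exact ⟨ω, h.isGoodOutcome_of_forall_notMem_badEvent hδ hpos hω⟩

end IsRound

end Outcome

section Next

variable {V ι α : Type*} [Fintype V] {G : ι → SimpleGraph V} {U : Finset V}
  {ω : V × α → Bool}

open scoped Classical in
/-- The vertices of `U` that are not colored in a round with outcome `ω`: a proposed color is
assigned unless a neighbor gets the same proposal. -/
noncomputable def uncolored (G : ι → SimpleGraph V) (U : Finset V) (ω : V × α → Bool) : Finset V :=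
  {v ∈ U | ∀ c, ω (v, c) = true → ω ∉ silent (blockers G v c)}

lemma mem_uncolored {v : V} :
    v ∈ uncolored G U ω ↔ v ∈ U ∧ ∀ c, ω (v, c) = true → ω ∉ silent (blockers G v c) := by
  classical
  simp only [uncolored, mem_filter]

lemma exists_of_notMem_uncolored {v : V} (hv : v ∈ U) (h : v ∉ uncolored G U ω) :
    ∃ c, ω (v, c) = true ∧ ω ∈ silent (blockers G v c) := by
  by_contra! hv'
  exact h (mem_uncolored.mpr ⟨hv, hv'⟩)

variable [Fintype α] {x : V → α → ℝ} {C : ℕ} {D M K ρ p δ r ρ' : ℝ}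

open scoped Classical in
/-- The weights after a round with outcome `ω`: the boosted weights of the surviving colors,
normalized to total weight `1` at every uncolored vertex. -/
noncomputable def nextWeight (G : ι → SimpleGraph V) (x : V → α → ℝ) (U : Finset V) (p : ℝ)
    (ω : V × α → Bool) (v : V) (c : α) : ℝ :=
  if v ∈ uncolored G U ω then
    (silent (blockers G v c)).indicator (fun _ => boosted G x p v c) ω / survivingWeight G x p v ω
  else 0

lemma nextWeight_of_notMem {v : V} (hv : v ∉ uncolored G U ω) (c : α) :
    nextWeight G x U p ω v c = 0 :=
  if_neg hv

lemma nextWeight_of_mem {v : V} (hv : v ∈ uncolored G U ω) (c : α) :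
    nextWeight G x U p ω v c =
      (silent (blockers G v c)).indicator (fun _ => boosted G x p v c) ω /
        survivingWeight G x p v ω :=
  if_pos hv

lemma of_nextWeight_pos (hx : ∀ v c, 0 ≤ x v c) {v : V} {c : α}
    (h : 0 < nextWeight G x U p ω v c) :
    v ∈ uncolored G U ω ∧ 0 < x v c ∧ ω ∈ silent (blockers G v c) := by
  have hv : v ∈ uncolored G U ω := by
    by_contra hv
    exact h.ne' (nextWeight_of_notMem hv c)
  rw [nextWeight_of_mem hv] at h
  refine ⟨hv, (hx v c).lt_of_ne' fun h0 => h.ne' ?_, ?_⟩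
  · rw [boosted_eq_zero h0, Set.indicator_zero, zero_div]
  · by_contra hc
    rw [Set.indicator_of_notMem hc, zero_div] at h
    exact h.false

section Good

variable [DecidableEq V] [DecidableEq α]

/- A color proposed for an uncolored vertex collides with a proposal at a neighbor, and the outer
blockers of the form `(w, c)` are silent because they are blockers of `c` at `u`. -/
lemma mem_silent_outerBlockers_or_mem_iUnion_collision {i : ι} {u : V} {c : α}
    (hu : u ∈ uncolored G U ω) (hc : ω ∈ silent (blockers G u c)) :
    ω ∈ silent (outerBlockers G i c u) ∨ ω ∈ ⋃ d, collision (u, d) (blockers G u d) := by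
  by_contra! h
  obtain ⟨hsilent, hconflict⟩ := h
  simp only [Set.mem_iUnion, mem_collision, not_exists, not_and] at hconflict
  refine hsilent fun ⟨w, d⟩ he => Bool.eq_false_of_not_eq_true fun hwd => ?_
  rcases mem_outerBlockers.mp he with ⟨rfl, -⟩ | ⟨⟨huw, -⟩, rfl⟩
  · exact (mem_uncolored.mp hu).2 d hwd fun e he =>
      Bool.eq_false_of_not_eq_true (hconflict d hwd e he)
  · exact Bool.false_ne_true ((hc (w, d) (mem_blockers.mpr ⟨huw, rfl⟩)).symm.trans hwd)

namespace IsGoodOutcome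

lemma nextWeight_mul_le (hω : IsGoodOutcome G x U p δ r ω) (hx : ∀ v c, 0 ≤ x v c) (hδ1 : δ ≤ 1 / 2)
    {v : V} (hv : v ∈ uncolored G U ω) (c : α) :
    nextWeight G x U p ω v c * (1 - δ) ≤
      (silent (blockers G v c)).indicator (fun _ => boosted G x p v c) ω := by
  have hsurv := hω.lt_survivingWeight v (mem_uncolored.mp hv).1
  rw [nextWeight_of_mem hv, div_mul_eq_mul_div, div_le_iff₀ (by linarith)]
  exact mul_le_mul_of_nonneg_left hsurv.le
    (Set.indicator_nonneg (fun _ _ => boosted_nonneg hx v c) ω)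

lemma nextWeight_nonneg (hω : IsGoodOutcome G x U p δ r ω) (hx : ∀ v c, 0 ≤ x v c)
    (hδ1 : δ ≤ 1 / 2) (v : V) (c : α) : 0 ≤ nextWeight G x U p ω v c := by
  by_cases hv : v ∈ uncolored G U ω
  · rw [nextWeight_of_mem hv]
    exact div_nonneg (Set.indicator_nonneg (fun _ _ => boosted_nonneg hx v c) ω)
      (by linarith [hω.lt_survivingWeight v (mem_uncolored.mp hv).1])
  · exact (nextWeight_of_notMem hv c).ge

lemma sum_nextWeight (hω : IsGoodOutcome G x U p δ r ω) (hδ1 : δ ≤ 1 / 2) {v : V}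
    (hv : v ∈ uncolored G U ω) : ∑ c, nextWeight G x U p ω v c = 1 := by
  simp only [nextWeight_of_mem hv, ← sum_div]
  have hsurv : 0 < survivingWeight G x p v ω := by
    linarith [hω.lt_survivingWeight v (mem_uncolored.mp hv).1]
  exact div_self hsurv.ne'

lemma nextWeight_le (h : IsRound G x U C D M K ρ p) (hω : IsGoodOutcome G x U p δ r ω)
    (hδ1 : δ ≤ 1 / 2) (v : V) (c : α) : nextWeight G x U p ω v c ≤ 4 * K / D := by
  have hK := h.one_le_K
  have hD := h.one_le_D
  by_cases hv : v ∈ uncolored G U ω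
  · have hnext := hω.nextWeight_mul_le h.weighting.nonneg hδ1 hv c
    have hle : (silent (blockers G v c)).indicator (fun _ => boosted G x p v c) ω ≤
        2 * (K / D) := (Set.indicator_le_self' (fun _ _ => h.boosted_nonneg v c) ω).trans
      (h.boosted_le_div v c)
    have hhalf : nextWeight G x U p ω v c * (1 / 2) ≤ nextWeight G x U p ω v c * (1 - δ) :=
      mul_le_mul_of_nonneg_left (by linarith) (hω.nextWeight_nonneg h.weighting.nonneg hδ1 v c)
    rw [mul_div_assoc]
    linarith
  · rw [nextWeight_of_notMem hv]
    positivity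

lemma sum_nextWeight_mul_le (hω : IsGoodOutcome G x U p δ r ω) (hx : ∀ v c, 0 ≤ x v c)
    (hδ1 : δ ≤ 1 / 2) (i : ι) {v : V} {c : α} (hv : 0 < x v c) :
    (∑ u ∈ neighbors (G i) v, nextWeight G x U p ω u c) * (1 - δ) ≤ r := by
  refine le_trans ?_ (hω.idleWeight_add_conflictWeight_le i v c hv)
  rw [idleWeight, conflictWeight, eventWeight, eventWeight, sum_mul, ← sum_add_distrib]
  refine sum_le_sum fun u _ => ?_
  have hidle : 0 ≤ (silent (outerBlockers G i c u)).indicator (fun _ => boosted G x p u c) ω :=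
    Set.indicator_nonneg (fun _ _ => boosted_nonneg hx u c) ω
  have hconflict : 0 ≤ (⋃ d, collision (u, d) (blockers G u d)).indicator
      (fun _ => boosted G x p u c) ω :=
    Set.indicator_nonneg (fun _ _ => boosted_nonneg hx u c) ω
  by_cases hu : u ∈ uncolored G U ω
  · refine (hω.nextWeight_mul_le hx hδ1 hu c).trans ?_
    by_cases hc : ω ∈ silent (blockers G u c)
    · rw [Set.indicator_of_mem hc]
      rcases mem_silent_outerBlockers_or_mem_iUnion_collision (i := i) hu hc with h | h
      · rw [Set.indicator_of_mem h]
        exact le_add_of_nonneg_right hconflict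
      · rw [Set.indicator_of_mem h]
        exact le_add_of_nonneg_left hidle
    · rw [Set.indicator_of_notMem hc]
      exact add_nonneg hidle hconflict
  · rw [nextWeight_of_notMem hu, zero_mul]
    exact add_nonneg hidle hconflict

lemma isWeighting_nextWeight (h : IsRound G x U C D M K ρ p) (hω : IsGoodOutcome G x U p δ r ω)
    (hδ1 : δ ≤ 1 / 2) (hr : r ≤ ρ' * (1 - δ)) :
    IsWeighting G (nextWeight G x U p ω) (uncolored G U ω) D M (4 * K) ρ' where
  nonneg := hω.nextWeight_nonneg h.weighting.nonneg hδ1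
  eq_zero _ hv c := nextWeight_of_notMem hv c
  sum_eq_one _ hv := hω.sum_nextWeight hδ1 hv
  color_degree_le i _ _ hvc := le_of_mul_le_mul_right
    ((hω.sum_nextWeight_mul_le h.weighting.nonneg hδ1 i
      (of_nextWeight_pos h.weighting.nonneg hvc).2.1).trans hr) (by linarith)
  le_div := nextWeight_le h hω hδ1
  card_support_le v := by
    refine le_trans ?_ (h.weighting.card_support_le v)
    exact mod_cast card_le_card (monotone_filter_right univ fun c _ hc =>
      (of_nextWeight_pos h.weighting.nonneg hc).2.1)

lemma hasWeightedColoring_of_uncolored (hω : IsGoodOutcome G x U p δ r ω)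
    (hx : ∀ v c, 0 ≤ x v c)
    (hφ : HasWeightedColoring G (nextWeight G x U p ω) (uncolored G U ω)) :
    HasWeightedColoring G x U := by
  obtain ⟨φ, hφpos, hφne⟩ := hφ
  have hcolor : ∀ v, ∃ c, v ∈ U → 0 < x v c ∧ ω ∈ silent (blockers G v c) ∧
      (v ∈ uncolored G U ω → c = φ v) ∧ (v ∉ uncolored G U ω → ω (v, c) = true) := by
    intro v
    by_cases hv : v ∈ uncolored G U ω
    · obtain ⟨-, hpos, hsilent⟩ := of_nextWeight_pos hx (hφpos v hv)
      exact ⟨φ v, fun _ => ⟨hpos, hsilent, fun _ => rfl, fun hv' => (hv' hv).elim⟩⟩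
    · by_cases hvU : v ∈ U
      · obtain ⟨c, hc, hsilent⟩ := exists_of_notMem_uncolored hvU hv
        exact ⟨c, fun _ =>
          ⟨hω.pos_of_eq_true v c hc, hsilent, fun hv' => (hv hv').elim, fun _ => hc⟩⟩
      · exact ⟨φ v, fun hvU' => (hvU hvU').elim⟩
  choose ψ hψ using hcolor
  refine ⟨ψ, fun v hv => (hψ v hv).1, fun u hu v hv huv heq => ?_⟩
  obtain ⟨-, hu_silent, hu_eq, hu_true⟩ := hψ u hu
  obtain ⟨-, hv_silent, hv_eq, hv_true⟩ := hψ v hv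
  by_cases hu' : u ∈ uncolored G U ω
  · by_cases hv' : v ∈ uncolored G U ω
    · exact hφne u hu' v hv' huv (hu_eq hu' ▸ hv_eq hv' ▸ heq)
    · have := hu_silent (v, ψ v) (mem_blockers.mpr ⟨huv, heq.symm⟩)
      exact Bool.false_ne_true (this.symm.trans (hv_true hv'))
  · have := hv_silent (u, ψ u) (mem_blockers.mpr ⟨huv.symm, heq⟩)
    exact Bool.false_ne_true (this.symm.trans (hu_true hu'))

end IsGoodOutcome

end Good

theorem IsRound.exists_next (h : IsRound G x U C D M K ρ p) (hδ : 0 ≤ δ) (hδ1 : δ ≤ 1 / 2)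
    (hM : 0 ≤ M)
    (hstep : ρ * (Real.exp (-p + p * (K / D)) / (1 - p * ρ)) + 6 * C * p ^ 2 * ρ ^ 2 + 2 * δ ≤
      ρ' * (1 - δ))
    (hlll : (1 + C * D) ^ 4 * (1 + C * (M * D)) *
      (2 * Real.exp (-(δ ^ 2 / (24 * C * K ^ 2) * D))) ≤ 1 / 4) :
    ∃ (x' : V → α → ℝ) (U' : Finset V), IsWeighting G x' U' D M (4 * K) ρ' ∧
      (HasWeightedColoring G x' U' → HasWeightedColoring G x U) := by
  classical
  obtain ⟨ω, hω⟩ := h.exists_isGoodOutcome hδ (hδ1.trans (by norm_num)) hM hlll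
  exact ⟨_, _, hω.isWeighting_nextWeight h hδ1 hstep,
    hω.hasWeightedColoring_of_uncolored h.weighting.nonneg⟩

end Next

section Iteration

lemma eventually_local_lemma_condition (C : ℕ) {M κ : ℝ} (hM : 0 ≤ M) (hκ : 0 < κ) :
    ∀ᶠ D : ℝ in atTop,
      (1 + C * D) ^ 4 * (1 + C * (M * D)) * (2 * Real.exp (-(κ * D))) ≤ 1 / 4 := by
  have hlim : Tendsto (fun D : ℝ => 2 * ((1 + C : ℝ) ^ 4 * (1 + C * M)) *
      (D ^ 5 * Real.exp (-κ * D))) atTop (nhds 0) := by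
    simpa using (tendsto_rpow_mul_exp_neg_mul_atTop_nhds_zero 5 κ hκ).const_mul
      (2 * ((1 + C : ℝ) ^ 4 * (1 + C * M)))
  filter_upwards [hlim.eventually_le_const (by norm_num : (0 : ℝ) < 1 / 4),
    eventually_ge_atTop 1] with D hD hD1
  have hlin : ∀ a : ℝ, 1 + a * D ≤ (1 + a) * D := fun a => by linarith
  calc (1 + C * D) ^ 4 * (1 + C * (M * D)) * (2 * Real.exp (-(κ * D)))
      ≤ ((1 + C) * D) ^ 4 * ((1 + C * M) * D) * (2 * Real.exp (-(κ * D))) := by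
        rw [← mul_assoc (C : ℝ) M D]
        gcongr <;> exact hlin _
    _ = 2 * ((1 + C : ℝ) ^ 4 * (1 + C * M)) * (D ^ 5 * Real.exp (-κ * D)) := by
        rw [neg_mul]
        ring
    _ ≤ 1 / 4 := hD

lemma eventually_exp_div_le (K p : ℝ) {δ : ℝ} (hδ : 0 < δ) :
    ∀ᶠ D : ℝ in atTop, Real.exp (p * (K / D)) ≤ 1 + δ := by
  have hlim : Tendsto (fun D : ℝ => p * (K / D)) atTop (nhds 0) := by
    simpa using (tendsto_const_nhds.div_atTop Filter.tendsto_id).const_mul p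
  have hexp := (Real.continuous_exp.tendsto 0).comp hlim
  rw [Real.exp_zero] at hexp
  exact hexp.eventually_le_const (by linarith)

lemma exp_neg_div_one_sub_le {p ρ : ℝ} (hp : 0 ≤ p) (hρ : 0 ≤ ρ) (hpρ : p + ρ ≤ 1) :
    Real.exp (-p) / (1 - p * ρ) ≤ 1 - p * (1 - ρ) + p ^ 2 := by
  have hexp : Real.exp (-p) ≤ 1 - p + p ^ 2 := by
    have := (abs_le.mp (Real.abs_exp_sub_one_sub_id_le (x := -p)
      (by rw [abs_neg, abs_of_nonneg hp]; linarith))).2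
    linarith [neg_sq p]
  rw [div_le_iff₀ (by nlinarith)]
  have : 0 ≤ p ^ 2 * ρ * (1 - ρ - p) := mul_nonneg (by positivity) (by linarith)
  linarith

/- The factor `1 - p * (1 - ρ)` is a gain of at least `p * η`; the second-order terms and the
deviations `δ` use up at most three quarters of it. -/
lemma next_color_degree_le {C : ℕ} {η p δ ρ e : ℝ} (hp : p * (1 + 6 * C) = η / 4) (hp0 : 0 ≤ p)
    (hδ0 : 0 ≤ δ) (hδ : 8 * δ ≤ ρ * (p * η)) (hρ0 : 0 ≤ ρ) (hρ1 : ρ ≤ 1 - η) (he : e ≤ 1 + δ) :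
    ρ * (Real.exp (-p) * e / (1 - p * ρ)) + 6 * C * p ^ 2 * ρ ^ 2 + 2 * δ ≤
      ρ * (1 - p * η / 4) * (1 - δ) := by
  have hpη : 4 * p ≤ η := by nlinarith [mul_nonneg hp0 (Nat.cast_nonneg (α := ℝ) C)]
  set g := 1 - p * (1 - ρ) + p ^ 2
  have hexp : Real.exp (-p) / (1 - p * ρ) ≤ g := exp_neg_div_one_sub_le hp0 hρ0 (by linarith)
  have : 0 ≤ g := (div_nonneg (Real.exp_pos _).le (by nlinarith)).trans hexp
  have hg1 : g ≤ 1 := by nlinarith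
  have hg : g + 6 * C * p ^ 2 ≤ 1 - 3 / 4 * (p * η) := by
    have : g ≤ 1 - p * η + p ^ 2 := by nlinarith
    have : p ^ 2 + 6 * C * p ^ 2 = p * η / 4 := by
      rw [mul_div_assoc, ← hp]
      ring
    linarith
  have hprod : Real.exp (-p) / (1 - p * ρ) * e ≤ g * (1 + δ) :=
    (mul_le_mul_of_nonneg_left he (div_nonneg (Real.exp_pos _).le (by nlinarith))).trans
      (mul_le_mul_of_nonneg_right hexp (by linarith))
  calc ρ * (Real.exp (-p) * e / (1 - p * ρ)) + 6 * C * p ^ 2 * ρ ^ 2 + 2 * δ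
      = ρ * (Real.exp (-p) / (1 - p * ρ) * e) + 6 * C * p ^ 2 * (ρ * ρ) + 2 * δ := by ring
    _ ≤ ρ * (g * (1 + δ)) + 6 * C * p ^ 2 * (ρ * 1) + 2 * δ := by
        gcongr
        linarith
    _ = ρ * (g + 6 * C * p ^ 2) + (ρ * g) * δ + 2 * δ := by ring
    _ ≤ ρ * (1 - 3 / 4 * (p * η)) + 1 * δ + 2 * δ := by
        gcongr
        nlinarith
    _ ≤ ρ * (1 - p * η / 4) - 1 * δ := by linarith
    _ ≤ ρ * (1 - p * η / 4) - ρ * (1 - p * η / 4) * δ := by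
        gcongr
        nlinarith
    _ = ρ * (1 - p * η / 4) * (1 - δ) := by ring

universe u v w

/-- All weightings of nearly disjoint families with these parameters have a proper coloring with
colors of positive weight. -/
def AlwaysColorable (C : ℕ) (D M K ρ : ℝ) : Prop :=
  ∀ (V : Type u) (ι : Type v) (α : Type w) [Fintype V] [Fintype α] [Nonempty α]
    (G : ι → SimpleGraph V) (x : V → α → ℝ) (U : Finset V),
    IsNearlyDisjointFamily G C D → IsWeighting G x U D M K ρ → HasWeightedColoring G x U

variable {C : ℕ} {D M K ρ η p : ℝ}

lemma alwaysColorable_of_le (hC : 1 ≤ C) (hρ0 : 0 ≤ ρ) (hρ : ρ ≤ 1 / (8 * C)) :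
    AlwaysColorable.{u, v, w} C D M K ρ := fun V ι α _ _ _ G x U hG hx => by
  refine hx.hasWeightedColoring_of_small hG hρ0 ?_
  have hC' : (1 : ℝ) ≤ C := mod_cast hC
  rw [le_div_iff₀ (by positivity)] at hρ
  linarith

lemma isRound_of_mul_eq {V : Type u} {ι : Type v} {α : Type w} [Fintype V] [Fintype α]
    {G : ι → SimpleGraph V} {x : V → α → ℝ} {U : Finset V} (hG : IsNearlyDisjointFamily G C D)
    (hx : IsWeighting G x U D M K ρ) (hC : 1 ≤ C) (hD : 1 ≤ D) (hK : 1 ≤ K) (hρ0 : 0 ≤ ρ)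
    (hρ1 : ρ ≤ 1) (hη1 : η ≤ 1) (hp0 : 0 ≤ p) (hp : p * (1 + 6 * C) = η / 4) :
    IsRound G x U C D M K ρ p := by
  have hpC : 0 ≤ p * C := by positivity
  refine ⟨hG, hx, hC, hD, hK, hρ0, hρ1, hp0, by linarith, ?_⟩
  calc p * (C * ρ) = p * C * ρ := by ring
    _ ≤ p * C * 1 := by gcongr
    _ ≤ 1 / 2 := by linarith

lemma AlwaysColorable.eventually_of_next (hC : 1 ≤ C) (hM : 0 ≤ M) (hK : 1 ≤ K) (hη0 : 0 < η)
    (hη1 : η ≤ 1) (hp0 : 0 < p) (hp : p * (1 + 6 * C) = η / 4) (hρ0 : 0 < ρ) (hρ1 : ρ ≤ 1 - η)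
    (h : ∀ᶠ D in atTop, AlwaysColorable.{u, v, w} C D M (4 * K) (ρ * (1 - p * η / 4))) :
    ∀ᶠ D in atTop, AlwaysColorable.{u, v, w} C D M K ρ := by
  have hpη : p * η ≤ 1 := by nlinarith [mul_nonneg hp0.le (Nat.cast_nonneg (α := ℝ) C)]
  set δ := ρ * (p * η) / 8 with hδ
  have hδ0 : 0 < δ := by positivity
  have hδ1 : δ ≤ 1 / 2 := by nlinarith
  have hκ : 0 < δ ^ 2 / (24 * C * K ^ 2) := by positivity
  filter_upwards [h, eventually_ge_atTop 1, eventually_exp_div_le K p hδ0,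
    eventually_local_lemma_condition C hM hκ] with D hnext hD hexp hlll
  intro V ι α _ _ _ G x U hG hx
  have hround : IsRound G x U C D M K ρ p :=
    isRound_of_mul_eq hG hx hC hD hK hρ0.le (by linarith) hη1 hp0.le hp
  obtain ⟨x', U', hx', hcol⟩ := hround.exists_next hδ0.le hδ1 hM (by
    rw [Real.exp_add]
    exact next_color_degree_le hp hp0.le hδ0.le (by linarith) hρ0.le hρ1 hexp) hlll
  exact hcol (hnext V ι α G x' U' hG hx')

lemma eventually_alwaysColorable_of_pow (hC : 1 ≤ C) (hM : 0 ≤ M) (hη0 : 0 < η) (hη1 : η ≤ 1)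
    (hp0 : 0 < p) (hp : p * (1 + 6 * C) = η / 4) (t : ℕ) :
    ∀ {K ρ : ℝ}, 1 ≤ K → 0 ≤ ρ → ρ ≤ 1 - η → ρ * (1 - p * η / 4) ^ t ≤ 1 / (8 * C) →
      ∀ᶠ D in atTop, AlwaysColorable.{u, v, w} C D M K ρ := by
  induction t with
  | zero =>
    intro K ρ _ hρ0 _ hρ
    exact .of_forall fun D => alwaysColorable_of_le hC hρ0 (by simpa using hρ)
  | succ t ih =>
    intro K ρ hK hρ0 hρ1 hρ
    rcases hρ0.eq_or_lt with rfl | hρpos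
    · exact .of_forall fun D => alwaysColorable_of_le hC le_rfl (by positivity)
    have hpη0 : 0 < p * η := by positivity
    have hpη : p * η ≤ 1 := by nlinarith [mul_nonneg hp0.le (Nat.cast_nonneg (α := ℝ) C)]
    refine AlwaysColorable.eventually_of_next hC hM hK hη0 hη1 hp0 hp hρpos hρ1
      (ih (by linarith) (mul_nonneg hρ0 (by linarith)) (by nlinarith) ?_)
    rwa [mul_assoc, ← pow_succ']

theorem eventually_alwaysColorable (hC : 1 ≤ C) (hM : 0 ≤ M) (hη0 : 0 < η) (hη1 : η ≤ 1) :
    ∀ᶠ D in atTop, AlwaysColorable.{u, v, w} C D M 1 (1 - η) := by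
  set p := η / 4 / (1 + 6 * C)
  have hp' : p * (1 + 6 * C) = η / 4 := div_mul_cancel₀ _ (by positivity)
  have hp0 : 0 < p := by positivity
  have hpη : p * η ≤ 1 := by nlinarith [mul_nonneg hp0.le (Nat.cast_nonneg (α := ℝ) C)]
  have hpη0 : 0 < p * η := by positivity
  obtain ⟨t, ht⟩ := exists_pow_lt_of_lt_one (show (0 : ℝ) < 1 / (8 * C) by positivity)
    (show 1 - p * η / 4 < 1 by linarith)
  refine eventually_alwaysColorable_of_pow hC hM hη0 hη1 hp0 hp' t le_rfl (by linarith) le_rfl ?_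
  exact (mul_le_of_le_one_left (pow_nonneg (by linarith) t) (by linarith)).trans ht.le

end Iteration

section Lists

universe u v w

/-- The weighting in which the colors of every list `L v` have equal weights of sum `1`. -/
noncomputable def uniformWeight {V α : Type*} (L : V → Finset α) (v : V) : α → ℝ :=
  (L v : Set α).indicator fun _ => (#(L v) : ℝ)⁻¹

lemma uniformWeight_pos {V α : Type*} {L : V → Finset α} {v : V} {c : α} :
    0 < uniformWeight L v c ↔ c ∈ L v := by
  by_cases hc : c ∈ L v
  · simpa [uniformWeight, hc] using ⟨c, hc⟩
  · simp [uniformWeight, hc]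

lemma isWeighting_uniformWeight {V ι α : Type*} [Fintype V] [Fintype α] {G : ι → SimpleGraph V}
    {C k : ℕ} {D M ρ : ℝ} (hG : IsNearlyDisjointFamily G C D) (hD : 0 < D) (hDk : D ≤ k)
    (hkM : k ≤ M * D) (hkρ : D ≤ ρ * k) {L : V → Finset α} (hL : ∀ v, #(L v) = k) :
    IsWeighting G (uniformWeight L) univ D M 1 ρ := by
  have hk : (0 : ℝ) < k := hD.trans_le hDk
  have hle : ∀ v c, uniformWeight L v c ≤ 1 / k := fun v c => by
    rw [uniformWeight, hL v, one_div]
    exact Set.indicator_apply_le' (fun _ => le_rfl) fun _ => by positivity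
  refine ⟨fun v c => Set.indicator_nonneg (fun _ _ => by positivity) c,
    fun v hv => absurd (mem_univ v) hv, fun v _ => ?_, fun i v c _ => ?_,
    fun v c => (hle v c).trans (by gcongr), fun v => ?_⟩
  · rw [uniformWeight, sum_indicator_subset _ (subset_univ (L v)), sum_const, nsmul_eq_mul,
      hL v, mul_inv_cancel₀ hk.ne']
  · calc ∑ u ∈ neighbors (G i) v, uniformWeight L u c
        ≤ #(neighbors (G i) v) * (1 / k) := by
          simpa using sum_le_card_nsmul _ _ _ fun u _ => hle u c
      _ ≤ D * (1 / k) := by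
          have := hG.card_neighbors_le i v
          gcongr
      _ ≤ ρ := by rwa [mul_one_div, div_le_iff₀ hk]
  · have : ({c | 0 < uniformWeight L v c} : Finset α) = L v := by
      ext c
      simp [uniformWeight_pos]
    rwa [this, hL v]

lemma AlwaysColorable.listColorable {V : Type u} {ι : Type v} {α : Type u} [Finite V]
    {G : ι → SimpleGraph V} {C k : ℕ} {D M ρ : ℝ}
    (h : AlwaysColorable.{u, v, u} C D M 1 ρ) (hG : IsNearlyDisjointFamily G C D) (hD : 0 < D)
    (hDk : D ≤ k) (hkM : k ≤ M * D) (hkρ : D ≤ ρ * k) {L : V → Finset α}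
    (hL : ∀ v, #(L v) = k) : (⨆ i, G i).ListColorable L := by
  classical
  have := Fintype.ofFinite V
  rcases isEmpty_or_nonempty V with hV | ⟨⟨v₀⟩⟩
  · exact ⟨.mk hV.elim fun {v} => hV.elim v, hV.elim⟩
  let S : Finset α := univ.biUnion L
  have hLS : ∀ v, L v ⊆ S := fun v => subset_biUnion_of_mem L (mem_univ v)
  let L' : V → Finset S := fun v => (L v).subtype (· ∈ S)
  have hL' : ∀ v, #(L' v) = k := fun v => by
    rw [card_subtype, filter_true_of_mem fun c hc => hLS v hc, hL v]
  have : Nonempty S := by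
    have hk : 0 < k := Nat.cast_pos.mp (hD.trans_le hDk)
    obtain ⟨c, -⟩ := card_pos.mp ((hL' v₀).symm ▸ hk)
    exact ⟨c⟩
  obtain ⟨φ, hφL, hφ⟩ := h V ι S G (uniformWeight L') univ hG
    (isWeighting_uniformWeight hG hD hDk hkM hkρ hL')
  refine ⟨.mk (fun v => φ v) fun {u v} huv heq => ?_, fun v => ?_⟩
  · exact hφ u (mem_univ u) v (mem_univ v) huv (Subtype.ext heq)
  · exact mem_subtype.mp (uniformWeight_pos.mp (hφL v (mem_univ v)))

theorem eventually_choosable_of_finite {C : ℕ} (hC : 1 ≤ C) {ε : ℝ} (hε : 0 < ε) :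
    ∀ᶠ D : ℝ in atTop, ∀ (V : Type u) (ι : Type v) [Finite V] (G : ι → SimpleGraph V),
      IsNearlyDisjointFamily G C D → (⨆ i, G i).Choosable ⌊(1 + ε) * D⌋₊ := by
  have hρ : (0 : ℝ) < 1 / (1 + ε / 2) := by positivity
  have hη : (0 : ℝ) < 1 - 1 / (1 + ε / 2) := by
    rw [sub_pos, div_lt_one (by positivity)]
    linarith
  filter_upwards [eventually_alwaysColorable.{u, v, u} hC (M := 1 + ε) (by linarith) hη
    (by linarith), eventually_ge_atTop 1, eventually_ge_atTop (2 / ε)] with D hcol hD hDε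
  intro V ι _ G hG α L hL
  rw [sub_sub_cancel] at hcol
  have hk : (1 + ε / 2) * D ≤ ⌊(1 + ε) * D⌋₊ := by
    rw [div_le_iff₀ hε] at hDε
    linarith [Nat.lt_floor_add_one ((1 + ε) * D)]
  choose L' hL'L hL' using fun v => exists_subset_card_eq (hL v)
  have hkρ : D ≤ 1 / (1 + ε / 2) * ⌊(1 + ε) * D⌋₊ := by
    rwa [one_div, ← div_eq_inv_mul, le_div_iff₀' (by positivity)]
  obtain ⟨φ, hφ⟩ := hcol.listColorable hG (by linarith) (by nlinarith)
    (Nat.floor_le (by positivity)) hkρ hL'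
  exact ⟨φ, fun v => hL'L v (hφ v)⟩

end Lists

section Subgraphs

universe u v

theorem listColorable_of_forall_finset {V α : Type u} {G : SimpleGraph V} {L : V → Finset α}
    (hL : ∀ v, (L v).Nonempty)
    (h : ∀ s : Finset V, (G.induce (s : Set V)).ListColorable fun v => L v) :
    G.ListColorable L := by
  classical
  choose φ hφ using h
  let g : Finset V → (v : V) → L v := fun s v =>
    if hv : v ∈ s then ⟨φ s ⟨v, hv⟩, hφ s ⟨v, hv⟩⟩ else ⟨(hL v).choose, (hL v).choose_spec⟩
  obtain ⟨χ, hχ⟩ := rado_selection g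
  refine ⟨.mk (fun v => χ v) fun {u v} huv heq => ?_, fun v => (χ v).2⟩
  obtain ⟨t, hst, ht⟩ := hχ {u, v}
  have hu : u ∈ t := hst (by simp)
  have hv : v ∈ t := hst (by simp)
  rw [ht u (by simp), ht v (by simp)] at heq
  simp only [g, hu, hv, dif_pos] at heq
  exact (φ t).valid (v := ⟨u, hu⟩) (w := ⟨v, hv⟩) huv heq

lemma choosable_of_forall_finset {V : Type u} {G : SimpleGraph V} {k : ℕ} (hk : 1 ≤ k)
    (h : ∀ s : Finset V, (G.induce (s : Set V)).Choosable k) : G.Choosable k :=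
  fun α L hL => listColorable_of_forall_finset (fun v => card_pos.mp (hk.trans (hL v)))
    fun s => h s α (fun v => L v) fun v => hL v

lemma listChromaticNumber_le {V : Type u} {G : SimpleGraph V} {k : ℕ} (h : G.Choosable k) :
    G.listChromaticNumber ≤ k :=
  iInf₂_le k h

variable {V W : Type*} {ι : Type*} {G : ι → (⊤ : SimpleGraph V).Subgraph}

lemma iSup_spanningCoe_comap (f : W → V) :
    ⨆ i, (G i).spanningCoe.comap f = (⨆ i, G i).spanningCoe.comap f := by
  ext u v
  simp

lemma map_mem_verts_of_mem_support {H : (⊤ : SimpleGraph V).Subgraph} {f : W → V} {v : W}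
    (hv : v ∈ (H.spanningCoe.comap f).support) : f v ∈ H.verts := by
  obtain ⟨u, hu⟩ := hv
  exact H.edge_vert hu

lemma card_neighbors_comap_le [Finite W] {H : (⊤ : SimpleGraph V).Subgraph} {f : W → V}
    (hf : Injective f) {D : ℝ} (hD : 0 ≤ D) (hH : (H.eMaxDegree : ℝ≥0∞) ≤ ENNReal.ofReal D)
    (v : W) : (#(neighbors (H.spanningCoe.comap f) v) : ℝ) ≤ D := by
  rcases (neighbors (H.spanningCoe.comap f) v).eq_empty_or_nonempty with hv | ⟨u, hu⟩
  · simpa [hv] using hD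
  have hfv : f v ∈ H.verts := map_mem_verts_of_mem_support ⟨u, mem_neighbors.mp hu⟩
  have hle : (#(neighbors (H.spanningCoe.comap f) v) : ℕ∞) ≤ H.eMaxDegree := by
    rw [← Set.encard_coe_eq_coe_finsetCard, ← hf.encard_image]
    refine (Set.encard_le_encard ?_).trans
      (le_iSup₂ (f := fun v _ => (H.neighborSet v).encard) (f v) hfv)
    rintro _ ⟨w, hw, rfl⟩
    exact mem_neighbors.mp hw
  have := (ENat.toENNReal_le.mpr hle).trans hH
  rw [ENat.toENNReal_coe, ← ENNReal.ofReal_natCast] at this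
  exact (ENNReal.ofReal_le_ofReal_iff hD).mp this

lemma isNearlyDisjointFamily_comap [Finite W] {f : W → V} (hf : Injective f) {C : ℕ} {D : ℝ}
    (hD : 0 ≤ D) (hG : Pairwise fun i j => ((G i).verts ∩ (G j).verts).Subsingleton)
    (hdeg : ∀ i, ((G i).eMaxDegree : ℝ≥0∞) ≤ ENNReal.ofReal D)
    (hmem : ∀ v, {i | v ∈ (G i).verts}.encard ≤ C) :
    IsNearlyDisjointFamily (fun i => (G i).spanningCoe.comap f) C D where
  card_neighbors_le i := card_neighbors_comap_le hf hD (hdeg i)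
  encard_mem_support_le v :=
    le_trans (Set.encard_le_encard fun i (hi : v ∈ ((G i).spanningCoe.comap f).support) =>
      map_mem_verts_of_mem_support hi) (hmem (f v))
  subsingleton_support_inter _ _ hij _ hu _ hv :=
    hf (hG hij ⟨map_mem_verts_of_mem_support hu.1, map_mem_verts_of_mem_support hu.2⟩
      ⟨map_mem_verts_of_mem_support hv.1, map_mem_verts_of_mem_support hv.2⟩)

lemma encard_setOf_mem_verts_le_floor [Finite ι] {C : ℝ}
    (hmem : ∀ v ∈ ⋃ i, (G i).verts, ({i | v ∈ (G i).verts}.ncard : ℝ) ≤ C) (v : V) :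
    {i | v ∈ (G i).verts}.encard ≤ ⌊C⌋₊ := by
  rcases {i | v ∈ (G i).verts}.eq_empty_or_nonempty with hv | ⟨i, hi⟩
  · simp [hv]
  · rw [← (Set.toFinite {i | v ∈ (G i).verts}).cast_ncard_eq, Nat.cast_le]
    exact Nat.le_floor (hmem v (Set.mem_iUnion.mpr ⟨i, hi⟩))

end Subgraphs

end NibbleColoring

theorem theorem1p1_general (C : ℕ) (ε : ℝ) (hε : 0 < ε) :
    ∃ D₀ : ℝ, ∀ D : ℝ, D₀ ≤ D →
      ∀ (V ι : Type*) (G : ι → (⊤ : SimpleGraph V).Subgraph),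
        (Pairwise fun i j => ((G i).verts ∩ (G j).verts).Subsingleton) →
        (∀ i, ((G i).eMaxDegree : ℝ≥0∞) ≤ ENNReal.ofReal D) →
        (∀ v, {i | v ∈ (G i).verts}.encard ≤ C) →
        ((⨆ i, G i).coe.listChromaticNumber : ℝ≥0∞) ≤ ENNReal.ofReal ((1 + ε) * D) := by
  obtain ⟨D₀, hD₀⟩ := Filter.eventually_atTop.mp
    ((NibbleColoring.eventually_choosable_of_finite (le_max_left 1 C) hε).and
      (Filter.eventually_ge_atTop 1))
  refine ⟨D₀, fun D hD V ι G hG hdeg hmem => ?_⟩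
  obtain ⟨hfin, hD1⟩ := hD₀ D hD
  have hchoose : (⨆ i, G i).coe.Choosable ⌊(1 + ε) * D⌋₊ := by
    refine NibbleColoring.choosable_of_forall_finset
      (Nat.le_floor (by push_cast; nlinarith)) fun s => ?_
    have := hfin s ι _ (NibbleColoring.isNearlyDisjointFamily_comap
      (f := fun v : (s : Set (⨆ i, G i).verts) => ((v : (⨆ i, G i).verts) : V))
      (Subtype.val_injective.comp Subtype.val_injective) (by linarith) hG hdeg
      fun v => (hmem v).trans (Nat.cast_le.mpr (le_max_right 1 C)))
    rwa [NibbleColoring.iSup_spanningCoe_comap] at this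
  calc ((⨆ i, G i).coe.listChromaticNumber : ℝ≥0∞)
      ≤ ⌊(1 + ε) * D⌋₊ := mod_cast NibbleColoring.listChromaticNumber_le hchoose
    _ ≤ ENNReal.ofReal ((1 + ε) * D) := by
        rw [← ENNReal.ofReal_natCast]
        exact ENNReal.ofReal_le_ofReal (Nat.floor_le (by positivity))

theorem theorem1p1 (C ε : ℝ) (hC : 0 < C) (hε : 0 < ε) :
    ∃ D₀ : ℝ, ∀ D : ℝ, D₀ ≤ D →
      ∀ (V : Type*) (m : ℕ) (G : Fin m → (⊤ : SimpleGraph V).Subgraph),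
        SimpleGraph.NearlyDisjoint G →
        (∀ i, ((G i).eMaxDegree : ℝ≥0∞) ≤ ENNReal.ofReal D) →
        (∀ v ∈ ⋃ i, (G i).verts, (({i | v ∈ (G i).verts} : Set (Fin m)).ncard : ℝ) ≤ C) →
        ((⨆ i, G i).coe.listChromaticNumber : ℝ≥0∞) ≤ ENNReal.ofReal ((1 + ε) * D) := by
  obtain ⟨D₀, hD₀⟩ := theorem1p1_general ⌊C⌋₊ ε hε
  exact ⟨D₀, fun D hD V m G hG hdeg hmem => hD₀ D hD V (Fin m) G
    (fun i j hij => Set.encard_le_one_iff_subsingleton.mp (hG i j hij)) hdeg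
    (NibbleColoring.encard_setOf_mem_verts_le_floor hmem)⟩
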